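/- **Six-vertex ensembles.** An arrow configuration is a quadruple $(i_1,j_1;i_2,j_2)\in\{0,1\}^4$ with $i_1+j_1=i_2+j_2$; here $i_1,j_1$ are the numbers of vertical and horizontal arrows entering a vertex, and $i_2,j_2$ the numbers of those exiting it. For $\Lambda\subseteq\mathbb{Z}^2$, let $\mathfrak{E}(\Lambda)$ be the set of six-vertex ensembles on $\Lambda$, that is, assignments of an arrow configuration to every vertex of $\Lambda$ such that $j_2(x,y)=j_1(x+1,y)$ and $i_2(x,y)=i_1(x,y+1)$ whenever both vertices lie in $\Lambda$; it carries the $\sigma$-algebra generated by cylinder sets. A domain is a set of vertices inducing a connected subgraph of $\mathbb{Z}^2$. **Pure states.** Given weights $w(i_1,j_1;i_2,j_2)$, a probability measure $\mu$ on $\mathfrak{E}(\mathbb{Z}^2)$ is a Gibbs measure if, for every finite domain $\Lambda'$, conditionally on $\mathcal{E}_{\mathbb{Z}^2\setminus\Lambda'}$ the restriction $\mathcal{E}_{\Lambda'}$ equals any given $\mathcal{E}'\in\mathfrak{E}(\Lambda')$ consistent with $\mathcal{E}_{\mathbb{Z}^2\setminus\Lambda'}$ with probability proportional to $\prod_{v\in\Lambda'}w_{\mathcal{E}'}(v)$,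 where $w_{\mathcal{E}'}(v)$ is the weight of the arrow configuration of $\mathcal{E}'$ at $v$. A pure state is a Gibbs measure that is invariant under all translations of $\mathbb{Z}^2$ and ergodic, meaning that every event invariant under all translations has probability $0$ or $1$. Its slope is $\big(\mathbb{E}_\mu[i_2(0,0)],\mathbb{E}_\mu[j_2(0,0)]\big)$. **The stochastic model.** The $(B_1,B_2)$-stochastic six-vertex model has weights $w(0,0;0,0)=w(1,1;1,1)=1$, $w(1,0;1,0)=B_1$, $w(1,0;0,1)=1-B_1$, $w(0,1;0,1)=B_2$, $w(0,1;1,0)=1-B_2$. On the quadrant $\mathbb{Z}_{>0}^2$, with given (possibly random) arrows entering from the $x$-axis and the $y$-axis, it is sampled by completing the arrow configurations one after the other along the diagonals $x+y=n$: given the entering arrows $(i_1,j_1)$ of a vertex, its exiting arrows are $(i_2,j_2)$ with probability $w(i_1,j_1;i_2,j_2)$, all choices being independent. Double-sided $(\rho_1,\rho_2)$-Bernoulli entrance data means that, independently, an arrow enters from each site of the $y$-axis with probability $\rho_1$ and from each site of the $x$-axis with probability $\rho_2$. **Proposition.** Let $0<B_1<B_2<1$ and $\rho\in[0,1]$, and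 set $$\kappa=\frac{1-B_1}{1-B_2},\qquad \varphi(z)=\frac{\kappa z}{(\kappa-1)z+1}.$$ Let $\mu_0(\rho)$ be the law on $\mathfrak{E}(\mathbb{Z}_{>0}^2)$ of the $(B_1,B_2)$-stochastic six-vertex model with double-sided $(\varphi(\rho),\rho)$-Bernoulli entrance data, and for every integer $N\ge 0$ let $\mu_N(\rho)$ be the measure on $\mathfrak{E}(\mathbb{Z}_{>-N}^2)$ obtained by translating $\mu_0(\rho)$ by $(-N,-N)$. Then the infinite-volume limit $\mu(\rho)=\lim_{N\to\infty}\mu_N(\rho)$ (in the sense of convergence of the probabilities of all cylinder events) exists as a probability measure on $\mathfrak{E}(\mathbb{Z}^2)$ and is unique, its restriction to $\mathfrak{E}(\mathbb{Z}_{>-N}^2)$ is $\mu_N(\rho)$ for every $N\ge0$, and $\mu(\rho)$ is a pure state of slope $(\rho,\varphi(\rho))$ for the $(B_1,B_2)$-stochastic six-vertex model. -/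

import Mathlib

open MeasureTheory ProbabilityTheory Filter Topology

namespace SixVertex

/-! ### Six-vertex ensembles -/

/-- The square lattice graph on `ℤ × ℤ`. -/
def latticeGraph : SimpleGraph (ℤ × ℤ) where
  Adj u v := |u.1 - v.1| + |u.2 - v.2| = 1
  symm := ⟨fun u v h => by rw [abs_sub_comm v.1, abs_sub_comm v.2]; exact h⟩
  loopless := ⟨fun u h => by simp at h⟩

/-- A domain: a set of vertices whose induced subgraph of the square lattice is connected. -/
def IsDomain (Λ : Set (ℤ × ℤ)) : Prop := (latticeGraph.induce Λ).Connected

/-- Arrow configurations `(i₁, j₁; i₂, j₂)`: `i₁`, `j₁` are the numbers of vertical and horizontal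
arrows entering the vertex, `i₂`, `j₂` the numbers of those exiting it. -/
@[ext]
structure ArrowConfig where
  i₁ : Fin 2
  j₁ : Fin 2
  i₂ : Fin 2
  j₂ : Fin 2
  conservation : (i₁ : ℕ) + (j₁ : ℕ) = (i₂ : ℕ) + (j₂ : ℕ)
deriving DecidableEq, Fintype

instance : MeasurableSpace ArrowConfig := ⊤

instance : DiscreteMeasurableSpace ArrowConfig := ⟨fun _ => trivial⟩

/-- The set `𝔈(Λ)` of six-vertex ensembles on `Λ`: assignments of an arrow configuration to each
vertex of `Λ` that are consistent along every edge between two vertices of `Λ`. As a subtype of a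
countable product of finite discrete spaces it carries the σ-algebra generated by the cylinder
sets. -/
abbrev Ensemble (Λ : Set (ℤ × ℤ)) : Type :=
  {E : Λ → ArrowConfig //
    (∀ (x y : ℤ) (h : (x, y) ∈ Λ) (h' : (x + 1, y) ∈ Λ),
      (E ⟨(x, y), h⟩).j₂ = (E ⟨(x + 1, y), h'⟩).j₁) ∧
    (∀ (x y : ℤ) (h : (x, y) ∈ Λ) (h' : (x, y + 1) ∈ Λ),
      (E ⟨(x, y), h⟩).i₂ = (E ⟨(x, y + 1), h'⟩).i₁)}

/-- The restriction of an ensemble to a smaller set of vertices. -/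
def restrict {Λ Λ' : Set (ℤ × ℤ)} (hΛ : Λ' ⊆ Λ) (E : Ensemble Λ) : Ensemble Λ' :=
  ⟨fun v => E.1 ⟨v.1, hΛ v.2⟩, fun x y h h' => E.2.1 x y (hΛ h) (hΛ h'),
    fun x y h h' => E.2.2 x y (hΛ h) (hΛ h')⟩

/-- The translation of an ensemble by `-u`: its configuration at `v` is the one of `E` at
`v + u`. -/
def translate {Λ Λ' : Set (ℤ × ℤ)} (u : ℤ × ℤ) (hu : ∀ v ∈ Λ', v + u ∈ Λ) (E : Ensemble Λ) :
    Ensemble Λ' :=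
  ⟨fun v => E.1 ⟨v.1 + u, hu v.1 v.2⟩, by
    refine ⟨fun x y h h' => ?_, fun x y h h' => ?_⟩
    · have e : (x + 1 + u.1, y + u.2) = (x + u.1 + 1, y + u.2) := by ext <;> simp; ring
      have h2 : (x + u.1 + 1, y + u.2) ∈ Λ := e ▸ hu _ h'
      have key : ∀ (w : ℤ × ℤ) (hw : w ∈ Λ), w = (x + u.1 + 1, y + u.2) →
          E.1 ⟨w, hw⟩ = E.1 ⟨(x + u.1 + 1, y + u.2), h2⟩ := by
        rintro w hw rfl; rfl
      exact (E.2.1 (x + u.1) (y + u.2) (hu _ h) h2).trans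
        (congrArg ArrowConfig.j₁ (key _ (hu _ h') e).symm)
    · have e : (x + u.1, y + 1 + u.2) = (x + u.1, y + u.2 + 1) := by ext <;> simp; ring
      have h2 : (x + u.1, y + u.2 + 1) ∈ Λ := e ▸ hu _ h'
      have key : ∀ (w : ℤ × ℤ) (hw : w ∈ Λ), w = (x + u.1, y + u.2 + 1) →
          E.1 ⟨w, hw⟩ = E.1 ⟨(x + u.1, y + u.2 + 1), h2⟩ := by
        rintro w hw rfl; rfl
      exact (E.2.2 (x + u.1) (y + u.2) (hu _ h) h2).trans
        (congrArg ArrowConfig.i₁ (key _ (hu _ h') e).symm)⟩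

/-- The translation of an ensemble on all of `ℤ × ℤ` by `-u`. -/
def translatePlane (u : ℤ × ℤ) : Ensemble Set.univ → Ensemble Set.univ :=
  translate u fun _ _ => Set.mem_univ _

/-- Two ensembles are consistent if they agree about the arrow on every edge from a vertex of one
to a vertex of the other. -/
def Consistent {Λ₁ Λ₂ : Set (ℤ × ℤ)} (E : Ensemble Λ₁) (H : Ensemble Λ₂) : Prop :=
  (∀ (x y : ℤ) (h : (x, y) ∈ Λ₁) (h' : (x + 1, y) ∈ Λ₂),
    (E.1 ⟨(x, y), h⟩).j₂ = (H.1 ⟨(x + 1, y), h'⟩).j₁) ∧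
  (∀ (x y : ℤ) (h : (x, y) ∈ Λ₁) (h' : (x, y + 1) ∈ Λ₂),
    (E.1 ⟨(x, y), h⟩).i₂ = (H.1 ⟨(x, y + 1), h'⟩).i₁) ∧
  (∀ (x y : ℤ) (h : (x, y) ∈ Λ₂) (h' : (x + 1, y) ∈ Λ₁),
    (H.1 ⟨(x, y), h⟩).j₂ = (E.1 ⟨(x + 1, y), h'⟩).j₁) ∧
  (∀ (x y : ℤ) (h : (x, y) ∈ Λ₂) (h' : (x, y + 1) ∈ Λ₁),
    (H.1 ⟨(x, y), h⟩).i₂ = (E.1 ⟨(x, y + 1), h'⟩).i₁)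

/-! ### Weights, Gibbs measures and pure states -/

/-- The six-vertex weights. -/
def weight (a₁ a₂ b₁ b₂ c₁ c₂ : ℝ) (c : ArrowConfig) : ℝ :=
  match c.i₁, c.j₁, c.i₂, c.j₂ with
  | 0, 0, 0, 0 => a₁
  | 1, 1, 1, 1 => a₂
  | 1, 0, 1, 0 => b₁
  | 0, 1, 0, 1 => b₂
  | 1, 0, 0, 1 => c₁
  | 0, 1, 1, 0 => c₂
  | _, _, _, _ => 0

/-- The weights of the `(B₁, B₂)`-stochastic six-vertex model. -/
def stochasticWeight (B₁ B₂ : ℝ) : ArrowConfig → ℝ :=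
  weight 1 1 B₁ B₂ (1 - B₁) (1 - B₂)

/-- The weight of an ensemble on a finite set: the product of the weights of its vertices. -/
noncomputable def ensembleWeight (w : ArrowConfig → ℝ) {Λ : Finset (ℤ × ℤ)}
    (E : Ensemble (Λ : Set (ℤ × ℤ))) : ℝ :=
  ∏ v : (Λ : Set (ℤ × ℤ)), w (E.1 v)

open Classical in
/-- The probability that the six-vertex model on `Λ`, with outside configuration `H`, assigns to
the ensemble `F`: it is `w(F) / Z` if `F` is consistent with `H`, where `Z` is the sum of the
weights of all ensembles on `Λ` consistent with `H`, and `0` otherwise. -/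
noncomputable def gibbsProb (w : ArrowConfig → ℝ) {Λ : Finset (ℤ × ℤ)} {Λ₂ : Set (ℤ × ℤ)}
    (H : Ensemble Λ₂) (F : Ensemble (Λ : Set (ℤ × ℤ))) : ℝ :=
  if Consistent F H then
    ensembleWeight w F /
      ∑ F' : Ensemble (Λ : Set (ℤ × ℤ)), if Consistent F' H then ensembleWeight w F' else 0
  else 0

/-- The Gibbs property of a measure on `𝔈(Λ)`: for every finite subdomain `Λ'`, the conditional
probabilities of the restriction to `Λ'`, given the restriction to `Λ \ Λ'`, are those of the
six-vertex model on `Λ'`. -/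
def IsGibbs (w : ArrowConfig → ℝ) {Λ : Set (ℤ × ℤ)} (μ : Measure (Ensemble Λ)) : Prop :=
  ∀ (Λ' : Finset (ℤ × ℤ)) (hΛ' : (Λ' : Set (ℤ × ℤ)) ⊆ Λ), IsDomain (Λ' : Set (ℤ × ℤ)) →
    ∀ F : Ensemble (Λ' : Set (ℤ × ℤ)),
      μ⟦{E : Ensemble Λ | restrict hΛ' E = F} |
          MeasurableSpace.comap (restrict (Λ' := Λ \ (Λ' : Set (ℤ × ℤ))) Set.sdiff_subset)
            inferInstance⟧
        =ᵐ[μ] fun E =>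
          gibbsProb w (restrict (Λ' := Λ \ (Λ' : Set (ℤ × ℤ))) Set.sdiff_subset E) F

/-- Translation-invariance of a measure on `𝔈(ℤ²)`. -/
def IsTranslationInvariant (μ : Measure (Ensemble Set.univ)) : Prop :=
  ∀ u : ℤ × ℤ, μ.map (translatePlane u) = μ

/-- Every translation-invariant event has probability `0` or `1`. -/
def IsErgodic (μ : Measure (Ensemble Set.univ)) : Prop :=
  ∀ A : Set (Ensemble Set.univ), MeasurableSet A →
    (∀ u : ℤ × ℤ, translatePlane u ⁻¹' A = A) → μ A = 0 ∨ μ A = 1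

/-- A pure state: a translation-invariant, ergodic Gibbs probability measure on `𝔈(ℤ²)`. -/
structure IsPureState (w : ArrowConfig → ℝ) (μ : Measure (Ensemble Set.univ)) : Prop where
  isProbabilityMeasure : IsProbabilityMeasure μ
  translationInvariant : IsTranslationInvariant μ
  ergodic : IsErgodic μ
  gibbs : IsGibbs w μ

/-- The number `χ⁽ᵛ⁾(v)` of arrows exiting `v` vertically. -/
def chiV {Λ : Set (ℤ × ℤ)} (v : Λ) (E : Ensemble Λ) : ℝ := ((E.1 v).i₂ : ℕ)

/-- The number `χ⁽ʰ⁾(v)` of arrows exiting `v` horizontally. -/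
def chiH {Λ : Set (ℤ × ℤ)} (v : Λ) (E : Ensemble Λ) : ℝ := ((E.1 v).j₂ : ℕ)

/-- The slope of a measure on `𝔈(ℤ²)`: the expectations of `χ⁽ᵛ⁾(0,0)` and `χ⁽ʰ⁾(0,0)`. -/
noncomputable def slope (μ : Measure (Ensemble Set.univ)) : ℝ × ℝ :=
  (∫ E, chiV ⟨(0, 0), Set.mem_univ _⟩ E ∂μ, ∫ E, chiH ⟨(0, 0), Set.mem_univ _⟩ E ∂μ)

/-! ### The stochastic six-vertex model on the quadrant -/

/-- The quadrant `ℤ_{> -N} × ℤ_{> -N}`; for `N = 0` this is the positive quadrant. -/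
def quadrant (N : ℕ) : Set (ℤ × ℤ) := {v | -(N : ℤ) < v.1 ∧ -(N : ℤ) < v.2}

/-- Entrance data on the positive quadrant: `west k` is the number of arrows entering from the site
`(0, k + 1)` of the `y`-axis, `south k` the number of those entering from the site `(k + 1, 0)` of
the `x`-axis. -/
abbrev EntranceData : Type := (ℕ → Fin 2) × (ℕ → Fin 2)

def EntranceData.west (u : EntranceData) : ℕ → Fin 2 := u.1

def EntranceData.south (u : EntranceData) : ℕ → Fin 2 := u.2

/-- Two coins at every vertex of the positive quadrant; `(x, y) : ℕ × ℕ` is the index of the vertex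
`(x + 1, y + 1)`. -/
abbrev Coins : Type := ℕ × ℕ → Fin 2 × Fin 2

/-- The completion of the half-configuration with `i` vertical and `j` horizontal entering arrows.
A single vertical arrow goes on vertically if the first coin is `1` and turns otherwise; a single
horizontal arrow goes on horizontally if the second coin is `1` and turns otherwise. -/
def complete (coin : Fin 2 × Fin 2) (i j : Fin 2) : ArrowConfig :=
  if _hij : i = j then ⟨i, j, i, j, rfl⟩
  else if i = 1 then
    if coin.1 = 1 then ⟨i, j, i, j, rfl⟩ else ⟨i, j, j, i, Nat.add_comm _ _⟩
  else
    if coin.2 = 1 then ⟨i, j, i, j, rfl⟩ else ⟨i, j, j, i, Nat.add_comm _ _⟩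

/-- The numbers of vertical and horizontal arrows entering the vertex `(x + 1, y + 1)`, obtained
from the entrance data by completing the configurations diagonal by diagonal. -/
def entering (u : EntranceData) (ξ : Coins) : ℕ → ℕ → Fin 2 × Fin 2
  | 0, 0 => (u.south 0, u.west 0)
  | x + 1, 0 =>
      (u.south (x + 1), (complete (ξ (x, 0)) (entering u ξ x 0).1 (entering u ξ x 0).2).j₂)
  | 0, y + 1 =>
      ((complete (ξ (0, y)) (entering u ξ 0 y).1 (entering u ξ 0 y).2).i₂, u.west (y + 1))
  | x + 1, y + 1 =>
      ((complete (ξ (x + 1, y)) (entering u ξ (x + 1) y).1 (entering u ξ (x + 1) y).2).i₂,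
        (complete (ξ (x, y + 1)) (entering u ξ x (y + 1)).1 (entering u ξ x (y + 1)).2).j₂)
  termination_by x y => x + y

/-- The arrow configuration sampled at the vertex `(x + 1, y + 1)`. -/
def sampleConfig (u : EntranceData) (ξ : Coins) (x y : ℕ) : ArrowConfig :=
  complete (ξ (x, y)) (entering u ξ x y).1 (entering u ξ x y).2

theorem complete_i₁ (coin : Fin 2 × Fin 2) (i j : Fin 2) : (complete coin i j).i₁ = i := by
  unfold complete; split_ifs <;> rfl

theorem complete_j₁ (coin : Fin 2 × Fin 2) (i j : Fin 2) : (complete coin i j).j₁ = j := by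
  unfold complete; split_ifs <;> rfl

theorem sampleConfig_horizontal (u : EntranceData) (ξ : Coins) (x y : ℕ) :
    (sampleConfig u ξ x y).j₂ = (sampleConfig u ξ (x + 1) y).j₁ := by
  rw [sampleConfig, sampleConfig, complete_j₁]
  cases y <;> simp [entering]

theorem sampleConfig_vertical (u : EntranceData) (ξ : Coins) (x y : ℕ) :
    (sampleConfig u ξ x y).i₂ = (sampleConfig u ξ x (y + 1)).i₁ := by
  rw [sampleConfig, sampleConfig, complete_i₁]
  cases x <;> simp [entering]

/-- The ensemble on the positive quadrant sampled from entrance data and coins. -/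
def sampleEnsemble (u : EntranceData) (ξ : Coins) : Ensemble (quadrant 0) :=
  ⟨fun v => sampleConfig u ξ (v.1.1 - 1).toNat (v.1.2 - 1).toNat, by
    refine ⟨fun x y h _ => ?_, fun x y h _ => ?_⟩
    · have hx : 0 < x := by simpa using h.1
      have e : (x + 1 - 1).toNat = (x - 1).toNat + 1 := by omega
      simp only [e]
      exact sampleConfig_horizontal u ξ _ _
    · have hy : 0 < y := by simpa using h.2
      have e : (y + 1 - 1).toNat = (y - 1).toNat + 1 := by omega
      simp only [e]
      exact sampleConfig_vertical u ξ _ _⟩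

/-- The Bernoulli distribution on `{0, 1}` with mean `p` (a parameter outside `[0, 1]` is replaced
by the nearest point of `[0, 1]`). -/
noncomputable def bern (p : ℝ) : Measure (Fin 2) :=
  bernoulliMeasure 1 0 (Set.projIcc (0 : ℝ) 1 zero_le_one p)

instance (p : ℝ) : IsProbabilityMeasure (bern p) := by
  unfold bern; infer_instance

/-- The law of independent coins: at every vertex the first has mean `B₁`, the second `B₂`. -/
noncomputable def coinLaw (B₁ B₂ : ℝ) : Measure Coins :=
  Measure.infinitePi fun _ : ℕ × ℕ => (bern B₁).prod (bern B₂)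

/-- Double-sided `(ρ₁, ρ₂)`-Bernoulli entrance data: independently, every site of the `y`-axis is
an entrance site with probability `ρ₁`, every site of the `x`-axis with probability `ρ₂`. -/
noncomputable def doubleBernoulli (ρ₁ ρ₂ : ℝ) : Measure EntranceData :=
  (Measure.infinitePi fun _ : ℕ => bern ρ₁).prod (Measure.infinitePi fun _ : ℕ => bern ρ₂)

/-- The `(B₁, B₂)`-stochastic six-vertex model on the positive quadrant with random entrance data
of the given law. -/
noncomputable def stochasticSixVertex (B₁ B₂ : ℝ) (entrance : Measure EntranceData) :
    Measure (Ensemble (quadrant 0)) :=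
  (entrance.prod (coinLaw B₁ B₂)).map fun p => sampleEnsemble p.1 p.2

/-! ### The measures `μ_N(ρ)` and their limit -/

/-- `κ = (1 - B₁) / (1 - B₂)`. -/
noncomputable def kappa (B₁ B₂ : ℝ) : ℝ := (1 - B₁) / (1 - B₂)

/-- `φ(z) = κ z / ((κ - 1) z + 1)`. -/
noncomputable def phi (B₁ B₂ z : ℝ) : ℝ :=
  kappa B₁ B₂ * z / ((kappa B₁ B₂ - 1) * z + 1)

/-- `μ₀(ρ)`: the stochastic six-vertex model on the positive quadrant with double-sided
`(φ(ρ), ρ)`-Bernoulli entrance data. -/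
noncomputable def mu₀ (B₁ B₂ ρ : ℝ) : Measure (Ensemble (quadrant 0)) :=
  stochasticSixVertex B₁ B₂ (doubleBernoulli (phi B₁ B₂ ρ) ρ)

/-- `μ_N(ρ)`: the translate of `μ₀(ρ)` by `(-N, -N)`, a measure on `𝔈(ℤ_{> -N} × ℤ_{> -N})`. -/
noncomputable def muN (B₁ B₂ ρ : ℝ) (N : ℕ) : Measure (Ensemble (quadrant N)) :=
  (mu₀ B₁ B₂ ρ).map <| translate ((N : ℤ), (N : ℤ)) fun v hv => by
    obtain ⟨h1, h2⟩ := hv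
    constructor
    · simp only [Prod.fst_add]; push_cast; linarith
    · simp only [Prod.snd_add]; push_cast; linarith

/-- `μ` is the infinite-volume limit of measures `ν N` on the ensembles on the quadrants: the
probability of every cylinder event converges. (The cylinder event on `Λ` makes sense in
`quadrant N` as soon as `N` is so large that `Λ ⊆ quadrant N`.) -/
def IsInfiniteVolumeLimit (ν : ∀ N : ℕ, Measure (Ensemble (quadrant N)))
    (μ : Measure (Ensemble Set.univ)) : Prop :=
  ∀ (Λ : Finset (ℤ × ℤ)) (F : Ensemble (Λ : Set (ℤ × ℤ))),
    Tendsto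
      (fun N : ℕ => ν N {E | ∀ (v : ℤ × ℤ) (hN : v ∈ quadrant N) (hΛ : v ∈ (Λ : Set (ℤ × ℤ))),
        E.1 ⟨v, hN⟩ = F.1 ⟨v, hΛ⟩})
      atTop (𝓝 (μ {E | restrict (Set.subset_univ _) E = F}))

end SixVertex

namespace SixVertex

/-! ### Weights of finite boxes -/

/-! Put `p = ρ` and `q = φ(ρ)`. Clearing denominators, `q = φ(p)` becomes the balance equation
`p(1-q)(1-B₁) = (1-p)q(1-B₂)`: at a vertex with independent Bernoulli entering arrows, a lone
vertical arrow turns as often as a lone horizontal one. Hence the exiting arrows are again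
independent with the same means (`sum_stochasticWeight_mul_exiting`).

Everything is read off one explicit family of weights, `boxWeight`. A maximal vertex can be summed
out because the weights are stochastic, a minimal one because of balance. The rectangle laws are
therefore consistent (`HasBoxLaw.rect_mono`), and every `μ_N` has the same law on each rectangle
inside its quadrant (`hasBoxLaw_muN`). Compactness yields a measure on the plane with all these
laws; cylinder probabilities are eventually constant in `N`, which gives the limit, its restrictions
and its uniqueness.

Translation invariance holds because the weight of a rectangle ignores its position. For ergodicity,
delete the upper right and lower left quarters of a large square: the two remaining squares share no
edge, so their configurations are independent (`HasBoxLaw.antidiagonal`), and an invariant event,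
being nearly a square event, satisfies `μ(A) = μ(A)²`. The Gibbs property follows because the weight
of a large square splits into a factor depending only on the outside of `D` and the six-vertex
weight on `D` (`exists_boxWeight_glue_eq`). The slope is a one-vertex computation. -/

instance : Inhabited ArrowConfig := ⟨⟨0, 0, 0, 0, rfl⟩⟩

/-- The discrete topology makes the space of configurations on the plane compact and its cylinder
sets clopen, as the limit argument requires. -/
instance : TopologicalSpace ArrowConfig := ⊥

instance : DiscreteTopology ArrowConfig := ⟨rfl⟩

theorem univ_arrowConfig : (Finset.univ : Finset ArrowConfig) =
    {⟨0, 0, 0, 0, rfl⟩, ⟨1, 1, 1, 1, rfl⟩, ⟨1, 0, 1, 0, rfl⟩, ⟨0, 1, 0, 1, rfl⟩,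
      ⟨1, 0, 0, 1, rfl⟩, ⟨0, 1, 1, 0, rfl⟩} := by
  decide

theorem sum_arrowConfig (f : ArrowConfig → ℝ) : ∑ c, f c =
    f ⟨0, 0, 0, 0, rfl⟩ + (f ⟨1, 1, 1, 1, rfl⟩ + (f ⟨1, 0, 1, 0, rfl⟩ + (f ⟨0, 1, 0, 1, rfl⟩ +
      (f ⟨1, 0, 0, 1, rfl⟩ + f ⟨0, 1, 1, 0, rfl⟩)))) := by
  rw [univ_arrowConfig]
  repeat rw [Finset.sum_insert (by decide)]
  rw [Finset.sum_singleton]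

/-- The mass that the Bernoulli distribution with mean `p` gives to `a`. -/
def bernWeight (p : ℝ) (a : Fin 2) : ℝ := if a = 1 then p else 1 - p

theorem bernWeight_nonneg {p : ℝ} (hp : p ∈ Set.Icc (0 : ℝ) 1) (a : Fin 2) :
    0 ≤ bernWeight p a := by
  unfold bernWeight; split_ifs
  · exact hp.1
  · linarith [hp.2]

theorem sum_bernWeight (p : ℝ) : ∑ a, bernWeight p a = 1 := by
  simp [bernWeight]

theorem bern_singleton {p : ℝ} (hp : p ∈ Set.Icc (0 : ℝ) 1) (a : Fin 2) :
    bern p {a} = ENNReal.ofReal (bernWeight p a) := by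
  rw [bern, Set.projIcc_of_mem zero_le_one hp]
  fin_cases a
  · rw [bernoulliMeasure_apply_of_notMem_of_mem _ (measurableSet_singleton _) (by simp) (by simp)]
    simp [bernWeight, ENNReal.ofReal, Real.toNNReal, unitInterval.toNNReal]
    congr 1
    exact NNReal.eq (max_eq_left (by linarith [hp.2])).symm
  · rw [bernoulliMeasure_apply_of_mem_of_notMem _ (measurableSet_singleton _) (by simp) (by simp)]
    simp [bernWeight, ENNReal.ofReal, Real.toNNReal, unitInterval.toNNReal]
    congr 1
    exact NNReal.eq (max_eq_left hp.1).symm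

theorem stochasticWeight_nonneg {B₁ B₂ : ℝ} (h₁ : B₁ ∈ Set.Icc (0 : ℝ) 1)
    (h₂ : B₂ ∈ Set.Icc (0 : ℝ) 1) (c : ArrowConfig) : 0 ≤ stochasticWeight B₁ B₂ c := by
  unfold stochasticWeight weight
  split <;> linarith [h₁.1, h₁.2, h₂.1, h₂.2]

/-- Completing the entering arrows of a vertex preserves the total weight. -/
theorem sum_stochasticWeight_mul_entering (B₁ B₂ : ℝ) (α β : Fin 2 → ℝ) :
    ∑ c, stochasticWeight B₁ B₂ c * α c.j₁ * β c.i₁ = (∑ j, α j) * ∑ i, β i := by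
  rw [sum_arrowConfig]
  simp [stochasticWeight, weight]
  ring

/-- If the entering arrows of a vertex are independent Bernoulli variables whose means satisfy the
balance equation, then so are the exiting ones. -/
theorem sum_stochasticWeight_mul_exiting {B₁ B₂ p q : ℝ}
    (hpq : p * (1 - q) * (1 - B₁) = (1 - p) * q * (1 - B₂)) (α β : Fin 2 → ℝ) :
    ∑ c, stochasticWeight B₁ B₂ c * bernWeight q c.j₁ * bernWeight p c.i₁ * (α c.j₂ * β c.i₂) =
      (∑ j, bernWeight q j * α j) * ∑ i, bernWeight p i * β i := by
  rw [sum_arrowConfig]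
  simp [stochasticWeight, weight, bernWeight]
  -- Only the two outcomes with a single exiting arrow could change probability; they do so by
  -- opposite multiples of the defect in the balance equation.
  linear_combination (α 1 * β 0 - α 0 * β 1) * hpq

/-- The parameters of the model: `p` is the density of vertical arrows, `q` that of horizontal
arrows. -/
structure Params where
  B₁ : ℝ
  B₂ : ℝ
  p : ℝ
  q : ℝ
  hB₁ : B₁ ∈ Set.Icc (0 : ℝ) 1
  hB₂ : B₂ ∈ Set.Icc (0 : ℝ) 1
  hp : p ∈ Set.Icc (0 : ℝ) 1
  hq : q ∈ Set.Icc (0 : ℝ) 1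
  balance : p * (1 - q) * (1 - B₁) = (1 - p) * q * (1 - B₂)

/-- The factor of the horizontal edge entering `v`: consistency with the neighbour if it lies in
`S`, the Bernoulli weight otherwise. -/
def hFactor (q : ℝ) (S : Finset (ℤ × ℤ)) (F : ℤ × ℤ → ArrowConfig) (v : ℤ × ℤ) : ℝ :=
  if (v.1 - 1, v.2) ∈ S then (if (F (v.1 - 1, v.2)).j₂ = (F v).j₁ then 1 else 0)
  else bernWeight q (F v).j₁

/-- The factor of the vertical edge entering `v`. -/
def vFactor (p : ℝ) (S : Finset (ℤ × ℤ)) (F : ℤ × ℤ → ArrowConfig) (v : ℤ × ℤ) : ℝ :=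
  if (v.1, v.2 - 1) ∈ S then (if (F (v.1, v.2 - 1)).i₂ = (F v).i₁ then 1 else 0)
  else bernWeight p (F v).i₁

/-- The weight of the configuration `F` on `S`, with independent Bernoulli arrows on the edges that
enter `S`. -/
noncomputable def boxWeight (P : Params) (S : Finset (ℤ × ℤ)) (F : ℤ × ℤ → ArrowConfig) : ℝ :=
  ∏ v ∈ S, (stochasticWeight P.B₁ P.B₂ (F v) * hFactor P.q S F v * vFactor P.p S F v)

theorem hFactor_nonneg {q : ℝ} (hq : q ∈ Set.Icc (0 : ℝ) 1) (S : Finset (ℤ × ℤ))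
    (F : ℤ × ℤ → ArrowConfig) (v : ℤ × ℤ) : 0 ≤ hFactor q S F v := by
  unfold hFactor; split_ifs
  exacts [zero_le_one, le_rfl, bernWeight_nonneg hq _]

theorem vFactor_nonneg {p : ℝ} (hp : p ∈ Set.Icc (0 : ℝ) 1) (S : Finset (ℤ × ℤ))
    (F : ℤ × ℤ → ArrowConfig) (v : ℤ × ℤ) : 0 ≤ vFactor p S F v := by
  unfold vFactor; split_ifs
  exacts [zero_le_one, le_rfl, bernWeight_nonneg hp _]

theorem boxWeight_nonneg (P : Params) (S : Finset (ℤ × ℤ)) (F : ℤ × ℤ → ArrowConfig) :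
    0 ≤ boxWeight P S F :=
  Finset.prod_nonneg fun _ _ => mul_nonneg (mul_nonneg (stochasticWeight_nonneg P.hB₁ P.hB₂ _)
    (hFactor_nonneg P.hq _ _ _)) (vFactor_nonneg P.hp _ _ _)

theorem hFactor_congr {q : ℝ} {S S' : Finset (ℤ × ℤ)} {F F' : ℤ × ℤ → ArrowConfig} {v : ℤ × ℤ}
    (hS : (v.1 - 1, v.2) ∈ S ↔ (v.1 - 1, v.2) ∈ S') (hv : F v = F' v)
    (hF : (v.1 - 1, v.2) ∈ S → F (v.1 - 1, v.2) = F' (v.1 - 1, v.2)) :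
    hFactor q S F v = hFactor q S' F' v := by
  unfold hFactor
  by_cases h : (v.1 - 1, v.2) ∈ S
  · rw [if_pos h, if_pos (hS.1 h), hv, hF h]
  · rw [if_neg h, if_neg (fun h' => h (hS.2 h')), hv]

theorem vFactor_congr {p : ℝ} {S S' : Finset (ℤ × ℤ)} {F F' : ℤ × ℤ → ArrowConfig} {v : ℤ × ℤ}
    (hS : (v.1, v.2 - 1) ∈ S ↔ (v.1, v.2 - 1) ∈ S') (hv : F v = F' v)
    (hF : (v.1, v.2 - 1) ∈ S → F (v.1, v.2 - 1) = F' (v.1, v.2 - 1)) :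
    vFactor p S F v = vFactor p S' F' v := by
  unfold vFactor
  by_cases h : (v.1, v.2 - 1) ∈ S
  · rw [if_pos h, if_pos (hS.1 h), hv, hF h]
  · rw [if_neg h, if_neg (fun h' => h (hS.2 h')), hv]

/-- Seen from `v`, the factor is a point mass or a Bernoulli mass in the entering arrow, a
probability vector either way; the left neighbour differs from `v`, so the update leaves it alone.
-/
theorem sum_hFactor_update (P : Params) (S : Finset (ℤ × ℤ)) (F : ℤ × ℤ → ArrowConfig)
    (v : ℤ × ℤ) :
    ∃ α : Fin 2 → ℝ, ∑ j, α j = 1 ∧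
      ∀ c, hFactor P.q S (Function.update F v c) v = α c.j₁ := by
  refine ⟨fun j => if (v.1 - 1, v.2) ∈ S then (if (F (v.1 - 1, v.2)).j₂ = j then 1 else 0)
    else bernWeight P.q j, ?_, fun c => ?_⟩
  · split_ifs
    · simp
    · exact sum_bernWeight _
  · have : (v.1 - 1, v.2) ≠ v := fun h => by simpa using congrArg Prod.fst h
    simp [hFactor, Function.update_of_ne this]

theorem sum_vFactor_update (P : Params) (S : Finset (ℤ × ℤ)) (F : ℤ × ℤ → ArrowConfig)
    (v : ℤ × ℤ) :
    ∃ β : Fin 2 → ℝ, ∑ i, β i = 1 ∧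
      ∀ c, vFactor P.p S (Function.update F v c) v = β c.i₁ := by
  refine ⟨fun i => if (v.1, v.2 - 1) ∈ S then (if (F (v.1, v.2 - 1)).i₂ = i then 1 else 0)
    else bernWeight P.p i, ?_, fun c => ?_⟩
  · split_ifs
    · simp
    · exact sum_bernWeight _
  · have : (v.1, v.2 - 1) ≠ v := fun h => by simpa using congrArg Prod.snd h
    simp [vFactor, Function.update_of_ne this]

/-- Summing out the configuration at a maximal vertex. -/
theorem sum_boxWeight_insert_of_maximal (P : Params) {S : Finset (ℤ × ℤ)} {v : ℤ × ℤ}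
    (hv : v ∉ S) (h₁ : (v.1 + 1, v.2) ∉ S) (h₂ : (v.1, v.2 + 1) ∉ S)
    (F : ℤ × ℤ → ArrowConfig) :
    ∑ c, boxWeight P (insert v S) (Function.update F v c) = boxWeight P S F := by
  -- By maximality no vertex of `S` receives an arrow from `v`, so `c` appears only in the factors
  -- at `v`.
  have key : ∀ c, boxWeight P (insert v S) (Function.update F v c) =
      stochasticWeight P.B₁ P.B₂ c * hFactor P.q (insert v S) (Function.update F v c) v *
        vFactor P.p (insert v S) (Function.update F v c) v * boxWeight P S F := by
    intro c
    unfold boxWeight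
    rw [Finset.prod_insert hv]
    congr 1
    · simp
    · refine Finset.prod_congr rfl fun u hu => ?_
      have huv : u ≠ v := fun h => hv (h ▸ hu)
      have e₁ : (u.1 - 1, u.2) ≠ v := fun h => h₁ (by rw [← h]; simpa using hu)
      have e₂ : (u.1, u.2 - 1) ≠ v := fun h => h₂ (by rw [← h]; simpa using hu)
      rw [Function.update_of_ne huv,
        hFactor_congr (S' := S) (F' := F) (by simp [e₁]) (Function.update_of_ne huv _ _)
          (fun _ => Function.update_of_ne e₁ _ _),
        vFactor_congr (S' := S) (F' := F) (by simp [e₂]) (Function.update_of_ne huv _ _)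
          (fun _ => Function.update_of_ne e₂ _ _)]
  obtain ⟨α, hα, hα'⟩ := sum_hFactor_update P (insert v S) F v
  obtain ⟨β, hβ, hβ'⟩ := sum_vFactor_update P (insert v S) F v
  simp_rw [key, hα', hβ']
  rw [← Finset.sum_mul, sum_stochasticWeight_mul_entering, hα, hβ, one_mul, one_mul]

/-- Only the right neighbour of `v` notices the insertion of `v`: its Bernoulli weight turns into a
consistency indicator `α`. Averaging that indicator against the Bernoulli law returns the old
weight. If the neighbour is not in `S`, `α = 1`. -/
theorem exists_prod_hFactor_update (P : Params) {S : Finset (ℤ × ℤ)} {v : ℤ × ℤ}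
    (hv : v ∉ S) (F : ℤ × ℤ → ArrowConfig) :
    ∃ (α : Fin 2 → ℝ) (r : ℝ), (∑ j, bernWeight P.q j * α j) * r = ∏ u ∈ S, hFactor P.q S F u ∧
      ∀ c, ∏ u ∈ S, hFactor P.q (insert v S) (Function.update F v c) u = α c.j₂ * r := by
  have hcongr : ∀ c, ∀ u ∈ S, u ≠ (v.1 + 1, v.2) →
      hFactor P.q (insert v S) (Function.update F v c) u = hFactor P.q S F u := by
    intro c u hu hne
    have huv : u ≠ v := fun h => hv (h ▸ hu)
    have e₁ : (u.1 - 1, u.2) ≠ v := fun h => hne (by rw [← h]; simp)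
    exact hFactor_congr (by simp [e₁]) (Function.update_of_ne huv _ _)
      (fun _ => Function.update_of_ne e₁ _ _)
  by_cases h : (v.1 + 1, v.2) ∈ S
  · refine ⟨fun j => if j = (F (v.1 + 1, v.2)).j₁ then 1 else 0,
      ∏ u ∈ S.erase (v.1 + 1, v.2), hFactor P.q S F u, ?_, fun c => ?_⟩
    · rw [← Finset.mul_prod_erase S _ h]
      simp [hFactor, hv]
    · rw [← Finset.mul_prod_erase S _ h]
      congr 1
      · have : (v.1 + 1, v.2) ≠ v := fun h => by simpa using congrArg Prod.fst h
        simp [hFactor, Function.update_of_ne this]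
      · exact Finset.prod_congr rfl fun u hu =>
          hcongr c u (Finset.mem_of_mem_erase hu) (Finset.ne_of_mem_erase hu)
  · refine ⟨fun _ => 1, ∏ u ∈ S, hFactor P.q S F u, ?_, fun c => ?_⟩
    · simp_rw [mul_one]; rw [sum_bernWeight, one_mul]
    · rw [one_mul]
      exact Finset.prod_congr rfl fun u hu => hcongr c u hu (fun e => h (e ▸ hu))

theorem exists_prod_vFactor_update (P : Params) {S : Finset (ℤ × ℤ)} {v : ℤ × ℤ}
    (hv : v ∉ S) (F : ℤ × ℤ → ArrowConfig) :
    ∃ (β : Fin 2 → ℝ) (r : ℝ), (∑ i, bernWeight P.p i * β i) * r = ∏ u ∈ S, vFactor P.p S F u ∧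
      ∀ c, ∏ u ∈ S, vFactor P.p (insert v S) (Function.update F v c) u = β c.i₂ * r := by
  have hcongr : ∀ c, ∀ u ∈ S, u ≠ (v.1, v.2 + 1) →
      vFactor P.p (insert v S) (Function.update F v c) u = vFactor P.p S F u := by
    intro c u hu hne
    have huv : u ≠ v := fun h => hv (h ▸ hu)
    have e₁ : (u.1, u.2 - 1) ≠ v := fun h => hne (by rw [← h]; simp)
    exact vFactor_congr (by simp [e₁]) (Function.update_of_ne huv _ _)
      (fun _ => Function.update_of_ne e₁ _ _)
  by_cases h : (v.1, v.2 + 1) ∈ S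
  · refine ⟨fun i => if i = (F (v.1, v.2 + 1)).i₁ then 1 else 0,
      ∏ u ∈ S.erase (v.1, v.2 + 1), vFactor P.p S F u, ?_, fun c => ?_⟩
    · rw [← Finset.mul_prod_erase S _ h]
      simp [vFactor, hv]
    · rw [← Finset.mul_prod_erase S _ h]
      congr 1
      · have : (v.1, v.2 + 1) ≠ v := fun h => by simpa using congrArg Prod.snd h
        simp [vFactor, Function.update_of_ne this]
      · exact Finset.prod_congr rfl fun u hu =>
          hcongr c u (Finset.mem_of_mem_erase hu) (Finset.ne_of_mem_erase hu)
  · refine ⟨fun _ => 1, ∏ u ∈ S, vFactor P.p S F u, ?_, fun c => ?_⟩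
    · simp_rw [mul_one]; rw [sum_bernWeight, one_mul]
    · rw [one_mul]
      exact Finset.prod_congr rfl fun u hu => hcongr c u hu (fun e => h (e ▸ hu))

/-- Summing out the configuration at a minimal vertex. -/
theorem sum_boxWeight_insert_of_minimal (P : Params) {S : Finset (ℤ × ℤ)} {v : ℤ × ℤ}
    (hv : v ∉ S) (h₁ : (v.1 - 1, v.2) ∉ S) (h₂ : (v.1, v.2 - 1) ∉ S)
    (F : ℤ × ℤ → ArrowConfig) :
    ∑ c, boxWeight P (insert v S) (Function.update F v c) = boxWeight P S F := by
  obtain ⟨α, r, hα, hα'⟩ := exists_prod_hFactor_update P hv F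
  obtain ⟨β, s, hβ, hβ'⟩ := exists_prod_vFactor_update P hv F
  have e₁ : (v.1 - 1, v.2) ≠ v := fun h => by simpa using congrArg Prod.fst h
  have e₂ : (v.1, v.2 - 1) ≠ v := fun h => by simpa using congrArg Prod.snd h
  -- By minimality both arrows entering `v` carry Bernoulli weights, which is the situation covered
  -- by the balance equation.
  have key : ∀ c, boxWeight P (insert v S) (Function.update F v c) =
      stochasticWeight P.B₁ P.B₂ c * bernWeight P.q c.j₁ * bernWeight P.p c.i₁ *
        (α c.j₂ * β c.i₂) * (r * s * ∏ u ∈ S, stochasticWeight P.B₁ P.B₂ (F u)) := by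
    intro c
    unfold boxWeight
    rw [Finset.prod_insert hv, Finset.prod_mul_distrib, Finset.prod_mul_distrib, hα', hβ',
      Finset.prod_congr rfl (g := fun u => stochasticWeight P.B₁ P.B₂ (F u)) fun u hu => by
        rw [Function.update_of_ne (ne_of_mem_of_not_mem hu hv)]]
    simp only [hFactor, vFactor, Function.update_self, Finset.mem_insert, e₁, e₂, h₁, h₂, or_self,
      if_false]
    ring
  simp_rw [key]
  rw [← Finset.sum_mul, sum_stochasticWeight_mul_exiting P.balance, boxWeight,
    Finset.prod_mul_distrib, Finset.prod_mul_distrib, ← hα, ← hβ]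
  ring

/-! ### Random fields with the stationary law on boxes -/

section BoxLaw

variable {Ω : Type*} [MeasurableSpace Ω] {P : Params} {μ : Measure Ω} {X : ℤ × ℤ → Ω → ArrowConfig}

/-- The random field `X` has the law on `S` given by `boxWeight`. -/
def HasBoxLaw (P : Params) (μ : Measure Ω) (X : ℤ × ℤ → Ω → ArrowConfig)
    (S : Finset (ℤ × ℤ)) : Prop :=
  ∀ F : ℤ × ℤ → ArrowConfig, μ {ω | ∀ v ∈ S, X v ω = F v} = ENNReal.ofReal (boxWeight P S F)

theorem measurableSet_agree (hX : ∀ v, Measurable (X v)) (S : Finset (ℤ × ℤ))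
    (F : ℤ × ℤ → ArrowConfig) : MeasurableSet {ω | ∀ v ∈ S, X v ω = F v} := by
  have : {ω | ∀ v ∈ S, X v ω = F v} = ⋂ v ∈ S, X v ⁻¹' {F v} := by ext; simp
  rw [this]
  exact S.measurableSet_biInter fun v _ => hX v (measurableSet_singleton _)

theorem sum_measure_agree_insert (hX : ∀ v, Measurable (X v)) {S : Finset (ℤ × ℤ)} {v : ℤ × ℤ}
    (hv : v ∉ S) (F : ℤ × ℤ → ArrowConfig) :
    ∑ c, μ {ω | ∀ u ∈ insert v S, X u ω = Function.update F v c u} =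
      μ {ω | ∀ u ∈ S, X u ω = F u} := by
  have h := sum_measure_preimage_singleton (μ := μ.restrict {ω | ∀ u ∈ S, X u ω = F u})
    (f := X v) Finset.univ fun c _ => hX v (measurableSet_singleton c)
  rw [Finset.coe_univ, Set.preimage_univ, Measure.restrict_apply_univ] at h
  rw [← h]
  refine Finset.sum_congr rfl fun c _ => ?_
  rw [Measure.restrict_apply (hX v (measurableSet_singleton c))]
  congr 1
  ext ω
  simp only [Finset.forall_mem_insert, Function.update_self, Set.mem_ofPred_eq, Set.mem_inter_iff,
    Set.mem_preimage, Set.mem_singleton_iff]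
  refine and_congr_right fun _ => forall₂_congr fun u hu => ?_
  rw [Function.update_of_ne (ne_of_mem_of_not_mem hu hv)]

theorem HasBoxLaw.of_insert (hX : ∀ v, Measurable (X v)) {S : Finset (ℤ × ℤ)} {v : ℤ × ℤ}
    (hv : v ∉ S) (hsum : ∀ F, ∑ c, boxWeight P (insert v S) (Function.update F v c) =
      boxWeight P S F) (h : HasBoxLaw P μ X (insert v S)) : HasBoxLaw P μ X S := by
  intro F
  rw [← sum_measure_agree_insert hX hv, ← hsum,
    ENNReal.ofReal_sum_of_nonneg fun _ _ => boxWeight_nonneg _ _ _]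
  exact Finset.sum_congr rfl fun c _ => h _

/-- The vertices of `T \ S` are removed in decreasing order of `x + y`. The hypothesis excludes
right and upper neighbours in `S`, the order excludes those in `T \ S`, so each removed vertex is
maximal. Only stochasticity of the weights is involved. -/
theorem HasBoxLaw.of_upper (hX : ∀ v, Measurable (X v)) {S T : Finset (ℤ × ℤ)}
    (hT : HasBoxLaw P μ X T) (hST : S ⊆ T)
    (h : ∀ v ∈ T \ S, (v.1 + 1, v.2) ∉ S ∧ (v.1, v.2 + 1) ∉ S) : HasBoxLaw P μ X S := by
  induction hn : (T \ S).card generalizing T with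
  | zero =>
    have : T ⊆ S := by simpa [Finset.sdiff_eq_empty_iff_subset] using hn
    rwa [Finset.Subset.antisymm hST this]
  | succ n ih =>
    obtain ⟨v, hv, hmax⟩ := Finset.exists_max_image (T \ S) (fun v => v.1 + v.2)
      (Finset.card_pos.1 (by omega))
    obtain ⟨hvT, hvS⟩ := Finset.mem_sdiff.1 hv
    have hcard : (T.erase v \ S).card = n := by
      rw [Finset.erase_sdiff_comm, Finset.card_erase_of_mem hv, hn, Nat.add_sub_cancel]
    refine ih ?_ ?_ ?_ hcard
    · rw [← Finset.insert_erase hvT] at hT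
      refine hT.of_insert hX (Finset.notMem_erase v T)
        (sum_boxWeight_insert_of_maximal P (Finset.notMem_erase v T) ?_ ?_)
      · intro hmem
        have := hmax _ (Finset.mem_sdiff.2 ⟨Finset.mem_of_mem_erase hmem, (h v hv).1⟩)
        simp only at this; omega
      · intro hmem
        have := hmax _ (Finset.mem_sdiff.2 ⟨Finset.mem_of_mem_erase hmem, (h v hv).2⟩)
        simp only at this; omega
    · exact fun u hu => Finset.mem_erase.2 ⟨fun e => hvS (e ▸ hu), hST hu⟩
    · intro u hu
      exact h u (Finset.sdiff_subset_sdiff (Finset.erase_subset _ _) le_rfl hu)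

/-- The mirror image, removing vertices in increasing order of `x + y`; here every removal relies on
balance. -/
theorem HasBoxLaw.of_lower (hX : ∀ v, Measurable (X v)) {S T : Finset (ℤ × ℤ)}
    (hT : HasBoxLaw P μ X T) (hST : S ⊆ T)
    (h : ∀ v ∈ T \ S, (v.1 - 1, v.2) ∉ S ∧ (v.1, v.2 - 1) ∉ S) : HasBoxLaw P μ X S := by
  induction hn : (T \ S).card generalizing T with
  | zero =>
    have : T ⊆ S := by simpa [Finset.sdiff_eq_empty_iff_subset] using hn
    rwa [Finset.Subset.antisymm hST this]
  | succ n ih =>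
    obtain ⟨v, hv, hmin⟩ := Finset.exists_min_image (T \ S) (fun v => v.1 + v.2)
      (Finset.card_pos.1 (by omega))
    obtain ⟨hvT, hvS⟩ := Finset.mem_sdiff.1 hv
    have hcard : (T.erase v \ S).card = n := by
      rw [Finset.erase_sdiff_comm, Finset.card_erase_of_mem hv, hn, Nat.add_sub_cancel]
    refine ih ?_ ?_ ?_ hcard
    · rw [← Finset.insert_erase hvT] at hT
      refine hT.of_insert hX (Finset.notMem_erase v T)
        (sum_boxWeight_insert_of_minimal P (Finset.notMem_erase v T) ?_ ?_)
      · intro hmem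
        have := hmin _ (Finset.mem_sdiff.2 ⟨Finset.mem_of_mem_erase hmem, (h v hv).1⟩)
        simp only at this; omega
      · intro hmem
        have := hmin _ (Finset.mem_sdiff.2 ⟨Finset.mem_of_mem_erase hmem, (h v hv).2⟩)
        simp only at this; omega
    · exact fun u hu => Finset.mem_erase.2 ⟨fun e => hvS (e ▸ hu), hST hu⟩
    · intro u hu
      exact h u (Finset.sdiff_subset_sdiff (Finset.erase_subset _ _) le_rfl hu)

/-- The rectangle `[a, b] × [c, d]`. -/
noncomputable def rect (a b c d : ℤ) : Finset (ℤ × ℤ) := Finset.Icc a b ×ˢ Finset.Icc c d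

theorem mem_rect {a b c d : ℤ} {v : ℤ × ℤ} :
    v ∈ rect a b c d ↔ (a ≤ v.1 ∧ v.1 ≤ b) ∧ (c ≤ v.2 ∧ v.2 ≤ d) := by
  simp [rect]

/-- Stationarity: the law on a rectangle is the marginal of the law on a larger one. -/
theorem HasBoxLaw.rect_mono (hX : ∀ v, Measurable (X v)) {a b c d a' b' c' d' : ℤ}
    (h : HasBoxLaw P μ X (rect a b c d)) (ha : a ≤ a') (hb : b' ≤ b) (hc : c ≤ c') (hd : d' ≤ d) :
    HasBoxLaw P μ X (rect a' b' c' d') := by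
  -- First trim the right and top strips, then the left and bottom ones.
  have h₁ : HasBoxLaw P μ X (rect a b' c d') := by
    refine h.of_upper hX (fun v => ?_) fun v => ?_
    · simp only [mem_rect]; omega
    · simp only [mem_rect, Finset.mem_sdiff]; omega
  refine h₁.of_lower hX (fun v => ?_) fun v => ?_
  · simp only [mem_rect]; omega
  · simp only [mem_rect, Finset.mem_sdiff]; omega

/-- No edge joins the two parts, so each edge factor tests membership in its own part only. -/
theorem boxWeight_union (P : Params) {A D : Finset (ℤ × ℤ)} (hAD : Disjoint A D)
    (h₁ : ∀ v ∈ A, (v.1 - 1, v.2) ∉ D ∧ (v.1, v.2 - 1) ∉ D)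
    (h₂ : ∀ v ∈ D, (v.1 - 1, v.2) ∉ A ∧ (v.1, v.2 - 1) ∉ A) (F : ℤ × ℤ → ArrowConfig) :
    boxWeight P (A ∪ D) F = boxWeight P A F * boxWeight P D F := by
  unfold boxWeight
  rw [Finset.prod_union hAD]
  congr 1
  · refine Finset.prod_congr rfl fun v hv => ?_
    rw [hFactor_congr (S' := A) (by simp [(h₁ v hv).1]) rfl fun _ => rfl,
      vFactor_congr (S' := A) (by simp [(h₁ v hv).2]) rfl fun _ => rfl]
  · refine Finset.prod_congr rfl fun v hv => ?_
    rw [hFactor_congr (S' := D) (by simp [(h₂ v hv).1]) rfl fun _ => rfl,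
      vFactor_congr (S' := D) (by simp [(h₂ v hv).2]) rfl fun _ => rfl]

/-- The configurations on two squares that are placed diagonally along the antidiagonal are
independent. -/
theorem HasBoxLaw.antidiagonal (hX : ∀ v, Measurable (X v)) {n : ℤ}
    (h : HasBoxLaw P μ X (rect (-n) (3 * n + 1) (-3 * n - 1) n)) (F : ℤ × ℤ → ArrowConfig) :
    μ {ω | ∀ v ∈ rect (-n) n (-n) n ∪ rect (n + 1) (3 * n + 1) (-3 * n - 1) (-n - 1),
        X v ω = F v} =
      ENNReal.ofReal (boxWeight P (rect (-n) n (-n) n) F) *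
        ENNReal.ofReal (boxWeight P (rect (n + 1) (3 * n + 1) (-3 * n - 1) (-n - 1)) F) := by
  -- The big square consists of four squares of side `2n + 1`. Removing the upper right one and then
  -- the lower left one leaves two that touch only at a corner.
  have h₁ : HasBoxLaw P μ X (rect (-n) (3 * n + 1) (-3 * n - 1) n \
      rect (n + 1) (3 * n + 1) (-n) n) := by
    refine h.of_upper hX Finset.sdiff_subset fun v => ?_
    simp only [mem_rect, Finset.mem_sdiff]; omega
  have h₂ : HasBoxLaw P μ X
      (rect (-n) n (-n) n ∪ rect (n + 1) (3 * n + 1) (-3 * n - 1) (-n - 1)) := by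
    refine h₁.of_lower hX (fun v => ?_) fun v => ?_
    · simp only [mem_rect, Finset.mem_sdiff, Finset.mem_union]; omega
    · simp only [mem_rect, Finset.mem_sdiff, Finset.mem_union]; omega
  rw [h₂, boxWeight_union, ENNReal.ofReal_mul (boxWeight_nonneg _ _ _)]
  · rw [Finset.disjoint_left]; intro v; simp only [mem_rect]; omega
  · intro v; simp only [mem_rect]; omega
  · intro v; simp only [mem_rect]; omega

end BoxLaw

/-- Position enters the weight only through which neighbours lie in the rectangle; this is the
source of translation invariance. -/
theorem boxWeight_translate (P : Params) (a b c d s t : ℤ) (F : ℤ × ℤ → ArrowConfig) :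
    boxWeight P (rect (a + s) (b + s) (c + t) (d + t)) F =
      boxWeight P (rect a b c d) fun v => F (v + (s, t)) := by
  unfold boxWeight
  refine Finset.prod_nbij' (fun v => v - (s, t)) (fun v => v + (s, t)) ?_ ?_ ?_ ?_ ?_
  · intro v; simp only [mem_rect, Prod.fst_sub, Prod.snd_sub]; omega
  · intro v; simp only [mem_rect, Prod.fst_add, Prod.snd_add]; omega
  · intro v _; simp
  · intro v _; simp
  · intro v _
    have e₁ : ((v - (s, t)).1 - 1, (v - (s, t)).2) + (s, t) = (v.1 - 1, v.2) := by
      ext <;> simp; ring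
    have e₂ : ((v - (s, t)).1, (v - (s, t)).2 - 1) + (s, t) = (v.1, v.2 - 1) := by
      ext <;> simp; ring
    refine congrArg₂ _ (congrArg₂ _ ?_ ?_) ?_
    · beta_reduce
      rw [sub_add_cancel]
    · unfold hFactor
      beta_reduce
      rw [e₁, sub_add_cancel]
      congr 1
      simp only [mem_rect, Prod.fst_sub, Prod.snd_sub, eq_iff_iff]; omega
    · unfold vFactor
      beta_reduce
      rw [e₂, sub_add_cancel]
      congr 1
      simp only [mem_rect, Prod.fst_sub, Prod.snd_sub, eq_iff_iff]; omega

/-! ### The configuration at a vertex -/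

open Classical in
/-- The configuration of an ensemble at `v`, a default value if `v ∉ Λ`. -/
noncomputable def config {Λ : Set (ℤ × ℤ)} (v : ℤ × ℤ) (E : Ensemble Λ) : ArrowConfig :=
  if h : v ∈ Λ then E.1 ⟨v, h⟩ else default

theorem config_of_mem {Λ : Set (ℤ × ℤ)} {v : ℤ × ℤ} (h : v ∈ Λ) (E : Ensemble Λ) :
    config v E = E.1 ⟨v, h⟩ := dif_pos h

theorem measurable_config {Λ : Set (ℤ × ℤ)} (v : ℤ × ℤ) :
    Measurable (config v : Ensemble Λ → ArrowConfig) := by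
  by_cases h : v ∈ Λ
  · have : (config v : Ensemble Λ → ArrowConfig) = fun E => E.1 ⟨v, h⟩ :=
      funext fun E => config_of_mem h E
    rw [this]
    exact (measurable_pi_apply _).comp measurable_subtype_coe
  · have : (config v : Ensemble Λ → ArrowConfig) = fun _ => default := by
      ext1 E; exact dif_neg h
    rw [this]; exact measurable_const

theorem measurable_restrict {Λ Λ' : Set (ℤ × ℤ)} (hΛ : Λ' ⊆ Λ) :
    Measurable (restrict hΛ) :=
  measurable_comap_iff.2 (measurable_pi_lambda _ fun v =>
    (measurable_pi_apply (⟨v.1, hΛ v.2⟩ : Λ)).comp measurable_subtype_coe)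

theorem measurable_translate {Λ Λ' : Set (ℤ × ℤ)} (u : ℤ × ℤ) (hu : ∀ v ∈ Λ', v + u ∈ Λ) :
    Measurable (translate u hu) :=
  measurable_comap_iff.2 (measurable_pi_lambda _ fun v =>
    (measurable_pi_apply (⟨v.1 + u, hu v.1 v.2⟩ : Λ)).comp measurable_subtype_coe)

theorem config_restrict {Λ Λ' : Set (ℤ × ℤ)} (hΛ : Λ' ⊆ Λ) {v : ℤ × ℤ} (hv : v ∈ Λ')
    (E : Ensemble Λ) : config v (restrict hΛ E) = config v E := by
  rw [config_of_mem hv, config_of_mem (hΛ hv)]; rfl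

theorem config_translate {Λ Λ' : Set (ℤ × ℤ)} (u : ℤ × ℤ) (hu : ∀ v ∈ Λ', v + u ∈ Λ) {v : ℤ × ℤ}
    (hv : v ∈ Λ') (E : Ensemble Λ) : config v (translate u hu E) = config (v + u) E := by
  rw [config_of_mem hv, config_of_mem (hu v hv)]; rfl

/-- A finite measure on ensembles is determined by the probabilities of sufficiently many cylinder
events. -/
theorem ext_of_agree {Λ : Set (ℤ × ℤ)} {μ ν : Measure (Ensemble Λ)} [IsFiniteMeasure μ]
    (h : ∀ I : Finset (ℤ × ℤ), ↑I ⊆ Λ → ∃ S : Finset (ℤ × ℤ), I ⊆ S ∧ ↑S ⊆ Λ ∧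
      ∀ F : ℤ × ℤ → ArrowConfig, μ {E | ∀ v ∈ S, config v E = F v} = ν {E | ∀ v ∈ S, config v E = F v}) : μ = ν := by
  classical
  have hproj : ∀ J : Finset Λ, (ν.map Subtype.val).map J.restrict =
      (μ.map Subtype.val).map J.restrict := by
    intro J
    obtain ⟨S, hJS, hS, hF⟩ := h (J.image Subtype.val) (by
      intro v hv; simp only [Finset.coe_image, Set.mem_image, Finset.mem_coe] at hv
      obtain ⟨w, -, rfl⟩ := hv; exact w.2)
    set T : Finset Λ := S.subtype (· ∈ Λ) with hT
    have hJT : J ⊆ T := fun v hv => by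
      rw [hT, Finset.mem_subtype]; exact hJS (Finset.mem_image_of_mem _ hv)
    have hTeq : (ν.map Subtype.val).map T.restrict = (μ.map Subtype.val).map T.restrict := by
      refine Measure.ext_of_singleton fun f => ?_
      have hm : MeasurableSet (T.restrict ⁻¹' {f} : Set (Λ → ArrowConfig)) :=
        Finset.measurable_restrict T (measurableSet_singleton f)
      rw [Measure.map_apply (Finset.measurable_restrict T) (measurableSet_singleton f),
        Measure.map_apply (Finset.measurable_restrict T) (measurableSet_singleton f),
        Measure.map_apply measurable_subtype_coe hm, Measure.map_apply measurable_subtype_coe hm]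
      -- The `default` branch is never used on `S`, since `S ⊆ Λ` and `T` is `S` viewed in `Λ`.
      have hset : (Subtype.val ⁻¹' (T.restrict ⁻¹' {f}) : Set (Ensemble Λ)) =
          {E | ∀ v ∈ S, config v E =
            (fun v => if h : ∃ h : v ∈ Λ, (⟨v, h⟩ : Λ) ∈ T then f ⟨⟨v, h.1⟩, h.2⟩ else default) v} := by
        ext E
        simp only [Set.mem_preimage, Set.mem_singleton_iff, Set.mem_ofPred_eq]
        constructor
        · rintro rfl v hv
          have hv' : ∃ h : v ∈ Λ, (⟨v, h⟩ : Λ) ∈ T := ⟨hS hv, by rw [hT, Finset.mem_subtype]; exact hv⟩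
          rw [dif_pos hv', config_of_mem hv'.1]; rfl
        · intro hE
          ext1 ⟨v, hv⟩
          have hvS : (v : ℤ × ℤ) ∈ S := by rw [hT, Finset.mem_subtype] at hv; exact hv
          have := hE v hvS
          rw [dif_pos ⟨v.2, hv⟩, config_of_mem v.2] at this
          exact this
      rw [hset, hF]
    have hcomp : (J.restrict : (Λ → ArrowConfig) → _) =
        Finset.restrict₂ (π := fun _ => ArrowConfig) hJT ∘ T.restrict := rfl
    rw [hcomp, ← Measure.map_map (Finset.measurable_restrict₂ hJT) (Finset.measurable_restrict T),
      ← Measure.map_map (Finset.measurable_restrict₂ hJT) (Finset.measurable_restrict T), hTeq]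
  have hfin : IsFiniteMeasure (μ.map (Subtype.val : Ensemble Λ → _)) := inferInstance
  -- Finite marginals determine a finite measure on the product space, and the σ-algebra of
  -- ensembles is pulled back from there.
  have heq : ν.map (Subtype.val : Ensemble Λ → _) = μ.map Subtype.val :=
    IsProjectiveLimit.unique (P := fun J : Finset Λ => (μ.map Subtype.val).map J.restrict)
      hproj (fun _ => rfl)
  refine Measure.ext fun s hs => ?_
  obtain ⟨t, ht, rfl⟩ := hs
  rw [← Measure.map_apply measurable_subtype_coe ht, ← Measure.map_apply measurable_subtype_coe ht,
    heq]

/-! ### The law of the stochastic model on squares -/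

theorem measurable_entering (x y : ℕ) :
    Measurable fun p : EntranceData × Coins => entering p.1 p.2 x y := by
  have hs : ∀ k, Measurable fun p : EntranceData × Coins => p.1.south k := fun k =>
    (measurable_pi_apply k).comp (measurable_snd.comp measurable_fst)
  have hw : ∀ k, Measurable fun p : EntranceData × Coins => p.1.west k := fun k =>
    (measurable_pi_apply k).comp (measurable_fst.comp measurable_fst)
  have hc : ∀ (f : ArrowConfig → Fin 2) (x y : ℕ),
      Measurable (fun p : EntranceData × Coins => entering p.1 p.2 x y) →
      Measurable fun p : EntranceData × Coins =>
        f (complete (p.2 (x, y)) (entering p.1 p.2 x y).1 (entering p.1 p.2 x y).2) := by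
    intro f x y h
    exact (Measurable.of_discrete (f := fun q : (Fin 2 × Fin 2) × (Fin 2 × Fin 2) =>
      f (complete q.1 q.2.1 q.2.2))).comp
        (((measurable_pi_apply (x, y)).comp measurable_snd).prodMk h)
  induction x, y using entering.induct with
  | case1 => simp only [entering]; exact (hs 0).prodMk (hw 0)
  | case2 x ih => simp only [entering]; exact (hs _).prodMk (hc _ _ _ ih)
  | case3 y ih => simp only [entering]; exact (hc _ _ _ ih).prodMk (hw _)
  | case4 x y ih₁ ih₂ => simp only [entering]; exact (hc _ _ _ ih₁).prodMk (hc _ _ _ ih₂)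

theorem measurable_sampleEnsemble :
    Measurable fun p : EntranceData × Coins => sampleEnsemble p.1 p.2 := by
  refine measurable_comap_iff.2 (measurable_pi_lambda _ fun v => ?_)
  exact (Measurable.of_discrete (f := fun q : (Fin 2 × Fin 2) × (Fin 2 × Fin 2) =>
      complete q.1 q.2.1 q.2.2)).comp
        (((measurable_pi_apply _).comp measurable_snd).prodMk (measurable_entering _ _))

theorem entering_south (u : EntranceData) (ξ : Coins) (x : ℕ) :
    (entering u ξ x 0).1 = u.south x := by cases x <;> simp [entering]

theorem entering_west (u : EntranceData) (ξ : Coins) (y : ℕ) :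
    (entering u ξ 0 y).2 = u.west y := by cases y <;> simp [entering]

theorem sampleConfig_i₁ (u : EntranceData) (ξ : Coins) (x y : ℕ) :
    (sampleConfig u ξ x y).i₁ = (entering u ξ x y).1 := complete_i₁ _ _ _

theorem sampleConfig_j₁ (u : EntranceData) (ξ : Coins) (x y : ℕ) :
    (sampleConfig u ξ x y).j₁ = (entering u ξ x y).2 := complete_j₁ _ _ _

/-- A consistent configuration on a square is sampled if and only if its entering arrows are the
entrance data and its vertices are the completions given by the coins. -/
theorem sampleConfig_eq_iff {k : ℕ} {G : ℕ → ℕ → ArrowConfig}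
    (hh : ∀ x < k, ∀ y < k + 1, (G x y).j₂ = (G (x + 1) y).j₁)
    (hv : ∀ x < k + 1, ∀ y < k, (G x y).i₂ = (G x (y + 1)).i₁) (u : EntranceData) (ξ : Coins) :
    (∀ x < k + 1, ∀ y < k + 1, sampleConfig u ξ x y = G x y) ↔
      (∀ y < k + 1, u.west y = (G 0 y).j₁) ∧ (∀ x < k + 1, u.south x = (G x 0).i₁) ∧
        ∀ x < k + 1, ∀ y < k + 1, complete (ξ (x, y)) (G x y).i₁ (G x y).j₁ = G x y := by
  constructor
  · intro h
    refine ⟨fun y hy => ?_, fun x hx => ?_, fun x hx y hy => ?_⟩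
    · rw [← h 0 (by omega) y hy, sampleConfig_j₁, entering_west]
    · rw [← h x hx 0 (by omega), sampleConfig_i₁, entering_south]
    · conv_rhs => rw [← h x hx y hy, sampleConfig, ← sampleConfig_i₁, ← sampleConfig_j₁, h x hx y hy]
  · rintro ⟨hw, hs, hc⟩
    -- Induction over diagonals: entering arrows come from the boundary or from the preceding
    -- diagonal.
    suffices ∀ n x y, x + y = n → x < k + 1 → y < k + 1 → sampleConfig u ξ x y = G x y from
      fun x hx y hy => this _ x y rfl hx hy
    intro n
    induction n using Nat.strong_induction_on with
    | _ n ih =>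
      intro x y hn hx hy
      have e₁ : (entering u ξ x y).1 = (G x y).i₁ := by
        cases y with
        | zero => rw [entering_south, hs x hx]
        | succ y =>
          rw [← sampleConfig_i₁, ← sampleConfig_vertical, ih (x + y) (by omega) x y rfl hx (by omega),
            hv x hx y (by omega)]
      have e₂ : (entering u ξ x y).2 = (G x y).j₁ := by
        cases x with
        | zero => rw [entering_west, hw y hy]
        | succ x =>
          rw [← sampleConfig_j₁, ← sampleConfig_horizontal,
            ih (x + y) (by omega) x y rfl (by omega) hy, hh x (by omega) y hy]
      rw [sampleConfig, e₁, e₂, hc x hx y hy]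

/-- Each configuration constrains at most one coin: none if the entering arrows are equal, the first
for a lone vertical arrow, the second for a lone horizontal one. -/
theorem complete_law {B₁ B₂ : ℝ} (h₁ : B₁ ∈ Set.Icc (0 : ℝ) 1) (h₂ : B₂ ∈ Set.Icc (0 : ℝ) 1)
    (g : ArrowConfig) : (bern B₁).prod (bern B₂) {c | complete c g.i₁ g.j₁ = g} =
      ENNReal.ofReal (stochasticWeight B₁ B₂ g) := by
  have hfst : ∀ a, (bern B₁).prod (bern B₂) {c | c.1 = a} = ENNReal.ofReal (bernWeight B₁ a) := by
    intro a
    have : {c : Fin 2 × Fin 2 | c.1 = a} = {a} ×ˢ Set.univ := by ext; simp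
    rw [this, Measure.prod_prod, bern_singleton h₁, measure_univ, mul_one]
  have hsnd : ∀ a, (bern B₁).prod (bern B₂) {c | c.2 = a} = ENNReal.ofReal (bernWeight B₂ a) := by
    intro a
    have : {c : Fin 2 × Fin 2 | c.2 = a} = Set.univ ×ˢ {a} := by ext; simp
    rw [this, Measure.prod_prod, bern_singleton h₂, measure_univ, one_mul]
  have hg : g ∈ (Finset.univ : Finset ArrowConfig) := Finset.mem_univ g
  rw [univ_arrowConfig] at hg
  simp only [Finset.mem_insert, Finset.mem_singleton] at hg
  rcases hg with rfl | rfl | rfl | rfl | rfl | rfl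
  · have : {c | complete c 0 0 = ⟨0, 0, 0, 0, rfl⟩} = Set.univ := by ext c; revert c; simp [complete]
    rw [this]; simp [stochasticWeight, weight]
  · have : {c | complete c 1 1 = ⟨1, 1, 1, 1, rfl⟩} = Set.univ := by ext c; revert c; simp [complete]
    rw [this]; simp [stochasticWeight, weight]
  · have : {c | complete c 1 0 = ⟨1, 0, 1, 0, rfl⟩} = {c | c.1 = 1} := by ext c; revert c; decide
    rw [this, hfst]; simp [stochasticWeight, weight, bernWeight]
  · have : {c | complete c 0 1 = ⟨0, 1, 0, 1, rfl⟩} = {c | c.2 = 1} := by ext c; revert c; decide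
    rw [this, hsnd]; simp [stochasticWeight, weight, bernWeight]
  · have : {c | complete c 1 0 = ⟨1, 0, 0, 1, rfl⟩} = {c | c.1 = 0} := by ext c; revert c; decide
    rw [this, hfst]; simp [stochasticWeight, weight, bernWeight]
  · have : {c | complete c 0 1 = ⟨0, 1, 1, 0, rfl⟩} = {c | c.2 = 0} := by ext c; revert c; decide
    rw [this, hsnd]; simp [stochasticWeight, weight, bernWeight]

theorem prod_rect (k : ℕ) (f : ℤ × ℤ → ℝ) : ∏ v ∈ rect 1 (k + 1) 1 (k + 1), f v =
    ∏ x ∈ Finset.range (k + 1), ∏ y ∈ Finset.range (k + 1), f (x + 1, y + 1) := by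
  have h : ∀ g : ℤ → ℝ, ∏ x ∈ Finset.Icc (1 : ℤ) (k + 1), g x =
      ∏ x ∈ Finset.range (k + 1), g (x + 1) := by
    intro g
    refine Finset.prod_nbij' (fun x => (x - 1).toNat) (fun x => (x : ℤ) + 1) ?_ ?_ ?_ ?_ ?_
    · intro x; simp only [Finset.mem_Icc, Finset.mem_range]; omega
    · intro x; simp only [Finset.mem_Icc, Finset.mem_range]; omega
    · intro x; simp only [Finset.mem_Icc]; omega
    · intro x; simp
    · intro x hx
      rw [Finset.mem_Icc] at hx
      congr 1; omega
  rw [rect, Finset.prod_product, h]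
  exact Finset.prod_congr rfl fun x _ => h _

/-- For a consistent configuration all interior edge factors equal `1`, leaving the Bernoulli
weights of the first column and first row: the product form of the sampling probability. -/
theorem boxWeight_square (P : Params) (k : ℕ) (F : ℤ × ℤ → ArrowConfig)
    (hh : ∀ x < k, ∀ y < k + 1,
      (F ((x : ℤ) + 1, (y : ℤ) + 1)).j₂ = (F (((x + 1 : ℕ) : ℤ) + 1, (y : ℤ) + 1)).j₁)
    (hv : ∀ x < k + 1, ∀ y < k,
      (F ((x : ℤ) + 1, (y : ℤ) + 1)).i₂ = (F ((x : ℤ) + 1, ((y + 1 : ℕ) : ℤ) + 1)).i₁) :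
    boxWeight P (rect 1 (k + 1) 1 (k + 1)) F =
      (∏ y ∈ Finset.range (k + 1), bernWeight P.q (F (1, (y : ℤ) + 1)).j₁) *
      (∏ x ∈ Finset.range (k + 1), bernWeight P.p (F ((x : ℤ) + 1, 1)).i₁) *
      ∏ c ∈ Finset.range (k + 1) ×ˢ Finset.range (k + 1),
        stochasticWeight P.B₁ P.B₂ (F ((c.1 : ℤ) + 1, (c.2 : ℤ) + 1)) := by
  have e₁ : ∏ x ∈ Finset.range (k + 1), ∏ y ∈ Finset.range (k + 1),
      hFactor P.q (rect 1 (k + 1) 1 (k + 1)) F ((x : ℤ) + 1, (y : ℤ) + 1) =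
        ∏ y ∈ Finset.range (k + 1), bernWeight P.q (F (1, (y : ℤ) + 1)).j₁ := by
    rw [Finset.prod_comm]
    refine Finset.prod_congr rfl fun y hy => ?_
    rw [Finset.mem_range] at hy
    rw [Finset.prod_range_succ', Finset.prod_eq_one, one_mul]
    · simp [hFactor, mem_rect]
    · intro x hx
      rw [Finset.mem_range] at hx
      have hm : ((x : ℤ) + 1, (y : ℤ) + 1) ∈ rect 1 (k + 1) 1 (k + 1) := by
        simp only [mem_rect]; omega
      have := hh x hx y hy
      simp only [Nat.cast_add, Nat.cast_one] at this
      simp [hFactor, hm, this]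
  have e₂ : ∏ x ∈ Finset.range (k + 1), ∏ y ∈ Finset.range (k + 1),
      vFactor P.p (rect 1 (k + 1) 1 (k + 1)) F ((x : ℤ) + 1, (y : ℤ) + 1) =
        ∏ x ∈ Finset.range (k + 1), bernWeight P.p (F ((x : ℤ) + 1, 1)).i₁ := by
    refine Finset.prod_congr rfl fun x hx => ?_
    rw [Finset.mem_range] at hx
    rw [Finset.prod_range_succ', Finset.prod_eq_one, one_mul]
    · simp [vFactor, mem_rect]
    · intro y hy
      rw [Finset.mem_range] at hy
      have hm : ((x : ℤ) + 1, (y : ℤ) + 1) ∈ rect 1 (k + 1) 1 (k + 1) := by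
        simp only [mem_rect]; omega
      have := hv x hx y hy
      simp only [Nat.cast_add, Nat.cast_one] at this
      simp [vFactor, hm, this]
  rw [boxWeight, prod_rect]
  simp_rw [Finset.prod_mul_distrib]
  rw [e₁, e₂, Finset.prod_product]
  ring

instance (ρ₁ ρ₂ : ℝ) : IsProbabilityMeasure (doubleBernoulli ρ₁ ρ₂) := by
  unfold doubleBernoulli; infer_instance

instance (B₁ B₂ : ℝ) : IsProbabilityMeasure (coinLaw B₁ B₂) := by
  unfold coinLaw; infer_instance

/-- Sampling a given consistent configuration is a product event in the independent entrance data
and coins. Balance plays no role yet. -/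
theorem hasBoxLaw_stochasticSixVertex (P : Params) (k : ℕ) :
    HasBoxLaw P (stochasticSixVertex P.B₁ P.B₂ (doubleBernoulli P.q P.p)) config
      (rect 1 (k + 1) 1 (k + 1)) := by
  intro F
  have hquad : ∀ x y : ℕ, ((x : ℤ) + 1, (y : ℤ) + 1) ∈ quadrant 0 := by
    intro x y; simp only [quadrant, Set.mem_ofPred_eq]; omega
  have hpre : (fun p : EntranceData × Coins => sampleEnsemble p.1 p.2) ⁻¹'
      {E | ∀ v ∈ rect 1 (k + 1) 1 (k + 1), config v E = F v} =
      {p | ∀ x < k + 1, ∀ y < k + 1,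
        sampleConfig p.1 p.2 x y = F ((x : ℤ) + 1, (y : ℤ) + 1)} := by
    ext p
    simp only [Set.mem_preimage, Set.mem_ofPred_eq]
    constructor
    · intro h x hx y hy
      have := h ((x : ℤ) + 1, (y : ℤ) + 1) (by simp only [mem_rect]; omega)
      rw [← this, config_of_mem (hquad x y)]
      simp [sampleEnsemble]
    · rintro h ⟨a, b⟩ hab
      simp only [mem_rect] at hab
      obtain ⟨x, rfl⟩ : ∃ x : ℕ, a = (x : ℤ) + 1 := ⟨(a - 1).toNat, by omega⟩
      obtain ⟨y, rfl⟩ : ∃ y : ℕ, b = (y : ℤ) + 1 := ⟨(b - 1).toNat, by omega⟩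
      rw [← h x (by omega) y (by omega), config_of_mem (hquad x y)]
      simp [sampleEnsemble]
  rw [stochasticSixVertex, Measure.map_apply measurable_sampleEnsemble
    (measurableSet_agree measurable_config _ _), hpre]
  -- A configuration inconsistent across an interior edge is never sampled, and the factor of that
  -- edge makes its weight vanish.
  by_cases hh : ∀ x < k, ∀ y < k + 1,
      (F ((x : ℤ) + 1, (y : ℤ) + 1)).j₂ = (F (((x + 1 : ℕ) : ℤ) + 1, (y : ℤ) + 1)).j₁
  swap
  · push Not at hh
    obtain ⟨x, hx, y, hy, hne⟩ := hh
    have hm : ((x : ℤ) + 1, (y : ℤ) + 1) ∈ rect 1 (k + 1) 1 (k + 1) := by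
      simp only [mem_rect]; omega
    have hm' : (((x + 1 : ℕ) : ℤ) + 1, (y : ℤ) + 1) ∈ rect 1 (k + 1) 1 (k + 1) := by
      simp only [mem_rect]; omega
    rw [boxWeight, Finset.prod_eq_zero hm', ENNReal.ofReal_zero]
    · convert measure_empty (μ := (doubleBernoulli P.q P.p).prod (coinLaw P.B₁ P.B₂))
      refine Set.eq_empty_of_forall_notMem fun p hp => hne ?_
      rw [← hp x (by omega) y hy, ← hp (x + 1) (by omega) y hy, sampleConfig_horizontal]
    · have : hFactor P.q (rect 1 (k + 1) 1 (k + 1)) F (((x + 1 : ℕ) : ℤ) + 1, (y : ℤ) + 1) = 0 := by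
        simp only [Nat.cast_add, Nat.cast_one] at hne
        simp [hFactor, hm, hne]
      rw [this, mul_zero, zero_mul]
  by_cases hv : ∀ x < k + 1, ∀ y < k,
      (F ((x : ℤ) + 1, (y : ℤ) + 1)).i₂ = (F ((x : ℤ) + 1, ((y + 1 : ℕ) : ℤ) + 1)).i₁
  swap
  · push Not at hv
    obtain ⟨x, hx, y, hy, hne⟩ := hv
    have hm : ((x : ℤ) + 1, (y : ℤ) + 1) ∈ rect 1 (k + 1) 1 (k + 1) := by
      simp only [mem_rect]; omega
    have hm' : ((x : ℤ) + 1, ((y + 1 : ℕ) : ℤ) + 1) ∈ rect 1 (k + 1) 1 (k + 1) := by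
      simp only [mem_rect]; omega
    rw [boxWeight, Finset.prod_eq_zero hm', ENNReal.ofReal_zero]
    · convert measure_empty (μ := (doubleBernoulli P.q P.p).prod (coinLaw P.B₁ P.B₂))
      refine Set.eq_empty_of_forall_notMem fun p hp => hne ?_
      rw [← hp x hx y (by omega), ← hp x hx (y + 1) (by omega), sampleConfig_vertical]
    · have : vFactor P.p (rect 1 (k + 1) 1 (k + 1)) F ((x : ℤ) + 1, ((y + 1 : ℕ) : ℤ) + 1) = 0 := by
        simp only [Nat.cast_add, Nat.cast_one] at hne
        simp [vFactor, hm, hne]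
      rw [this, mul_zero]
  have hset : {p : EntranceData × Coins | ∀ x < k + 1, ∀ y < k + 1,
        sampleConfig p.1 p.2 x y = F ((x : ℤ) + 1, (y : ℤ) + 1)} =
      (Set.pi (Finset.range (k + 1)) (fun y : ℕ => {(F (1, (y : ℤ) + 1)).j₁}) ×ˢ
        Set.pi (Finset.range (k + 1)) (fun x : ℕ => {(F ((x : ℤ) + 1, 1)).i₁})) ×ˢ
      Set.pi (Finset.range (k + 1) ×ˢ Finset.range (k + 1) : Finset (ℕ × ℕ)) (fun c : ℕ × ℕ =>
        {a | complete a (F ((c.1 : ℤ) + 1, (c.2 : ℤ) + 1)).i₁ (F ((c.1 : ℤ) + 1, (c.2 : ℤ) + 1)).j₁ =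
          F ((c.1 : ℤ) + 1, (c.2 : ℤ) + 1)}) := by
    ext ⟨u, ξ⟩
    have := sampleConfig_eq_iff (G := fun x y : ℕ => F ((x : ℤ) + 1, (y : ℤ) + 1)) hh hv u ξ
    simp only [Nat.cast_zero, zero_add] at this
    rw [Set.mem_ofPred_eq, this]
    simp only [EntranceData.west, EntranceData.south, Set.mem_prod, Set.mem_pi, Finset.mem_coe,
      Finset.mem_range, Finset.mem_product, Set.mem_singleton_iff, Set.mem_ofPred_eq, Prod.forall,
      and_assoc]
    refine and_congr_right fun _ => and_congr_right fun _ => ?_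
    exact ⟨fun h x y hxy => h x hxy.1 y hxy.2, fun h x hx y hy => h x y ⟨hx, hy⟩⟩
  rw [hset, Measure.prod_prod, doubleBernoulli, Measure.prod_prod, coinLaw,
    Measure.infinitePi_pi _ (fun _ _ => measurableSet_singleton _),
    Measure.infinitePi_pi _ (fun _ _ => measurableSet_singleton _),
    Measure.infinitePi_pi _ (fun _ _ => MeasurableSet.of_discrete), boxWeight_square P k F hh hv,
    ENNReal.ofReal_mul, ENNReal.ofReal_mul, ENNReal.ofReal_prod_of_nonneg,
    ENNReal.ofReal_prod_of_nonneg, ENNReal.ofReal_prod_of_nonneg]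
  · congr 1
    · congr 1
      · exact Finset.prod_congr rfl fun _ _ => bern_singleton P.hq _
      · exact Finset.prod_congr rfl fun _ _ => bern_singleton P.hp _
    · exact Finset.prod_congr rfl fun _ _ => complete_law P.hB₁ P.hB₂ _
  · exact fun _ _ => stochasticWeight_nonneg P.hB₁ P.hB₂ _
  · exact fun _ _ => bernWeight_nonneg P.hp _
  · exact fun _ _ => bernWeight_nonneg P.hq _
  · exact Finset.prod_nonneg fun _ _ => bernWeight_nonneg P.hq _
  · exact mul_nonneg (Finset.prod_nonneg fun _ _ => bernWeight_nonneg P.hq _)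
      (Finset.prod_nonneg fun _ _ => bernWeight_nonneg P.hp _)

instance (B₁ B₂ : ℝ) (ν : Measure EntranceData) [IsProbabilityMeasure ν] :
    IsProbabilityMeasure (stochasticSixVertex B₁ B₂ ν) :=
  Measure.isProbabilityMeasure_map measurable_sampleEnsemble.aemeasurable

instance (B₁ B₂ ρ : ℝ) (N : ℕ) : IsProbabilityMeasure (muN B₁ B₂ ρ N) := by
  unfold muN mu₀
  exact Measure.isProbabilityMeasure_map (measurable_translate _ _).aemeasurable

/-- The sampled law is known on squares at the corner of the quadrant; stationarity carries it to
any rectangle inside, so the answer does not depend on `N`. -/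
theorem hasBoxLaw_muN (P : Params) (hq : P.q = phi P.B₁ P.B₂ P.p) (N : ℕ) (a b c d : ℤ)
    (ha : -(N : ℤ) < a) (hc : -(N : ℤ) < c) :
    HasBoxLaw P (muN P.B₁ P.B₂ P.p N) config (rect a b c d) := by
  -- Large enough for the translated square `[1 - N, k + 1 - N]²` to reach past `b` and `d`.
  set k : ℕ := (max b d + N).toNat with hk
  have hbig : HasBoxLaw P (muN P.B₁ P.B₂ P.p N) config
      (rect (1 + -N) ((k + 1) + -N) (1 + -N) ((k + 1) + -N)) := by
    intro F
    rw [boxWeight_translate, ← hasBoxLaw_stochasticSixVertex P k, muN, mu₀, ← hq,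
      Measure.map_apply (measurable_translate _ _) (measurableSet_agree measurable_config _ _)]
    congr 1
    ext E
    simp only [Set.mem_preimage, Set.mem_ofPred_eq]
    constructor
    · intro h v hv
      have hm : v + (-(N : ℤ), -(N : ℤ)) ∈ rect (1 + -N) ((k + 1) + -N) (1 + -N) ((k + 1) + -N) := by
        simp only [mem_rect, Prod.fst_add, Prod.snd_add] at hv ⊢; omega
      rw [← h _ hm, config_translate]
      · congr 1; ext <;> simp
      · simp only [mem_rect, quadrant, Set.mem_ofPred_eq] at hm ⊢; omega
    · intro h v hv
      rw [config_translate]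
      · have hm : v + ((N : ℤ), (N : ℤ)) ∈ rect 1 (k + 1) 1 (k + 1) := by
          simp only [mem_rect, Prod.fst_add, Prod.snd_add] at hv ⊢; omega
        rw [h _ hm]
        congr 1; ext <;> simp
      · simp only [mem_rect, quadrant, Set.mem_ofPred_eq] at hv ⊢; omega
  exact hbig.rect_mono measurable_config (by omega) (by omega) (by omega) (by omega)

/-! ### Existence of the stationary measure on the plane -/

/-- Each of the finitely many mismatched pairs has weight `0` on the two-vertex rectangle. -/
theorem HasBoxLaw.ae_horizontal {Ω : Type*} [MeasurableSpace Ω] {P : Params} {μ : Measure Ω}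
    {X : ℤ × ℤ → Ω → ArrowConfig} (x y : ℤ) (h : HasBoxLaw P μ X (rect x (x + 1) y y)) :
    ∀ᵐ ω ∂μ, (X (x, y) ω).j₂ = (X (x + 1, y) ω).j₁ := by
  have hsub : {ω | ¬ (X (x, y) ω).j₂ = (X (x + 1, y) ω).j₁} ⊆
      ⋃ c : {c : ArrowConfig × ArrowConfig // c.1.j₂ ≠ c.2.j₁},
        {ω | ∀ v ∈ rect x (x + 1) y y, X v ω = if v.1 = x then c.1.1 else c.1.2} := by
    intro ω hω
    refine Set.mem_iUnion.2 ⟨⟨(X (x, y) ω, X (x + 1, y) ω), hω⟩, fun v hv => ?_⟩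
    rw [mem_rect] at hv
    split_ifs with hvx
    · congr 1; ext <;> simp only <;> omega
    · congr 1; ext <;> simp only <;> omega
  refine measure_mono_null hsub (measure_iUnion_null fun c => ?_)
  rw [h, boxWeight, Finset.prod_eq_zero (i := (x + 1, y)), ENNReal.ofReal_zero]
  · simp only [mem_rect]; omega
  · simp [hFactor, mem_rect, c.2]

theorem HasBoxLaw.ae_vertical {Ω : Type*} [MeasurableSpace Ω] {P : Params} {μ : Measure Ω}
    {X : ℤ × ℤ → Ω → ArrowConfig} (x y : ℤ) (h : HasBoxLaw P μ X (rect x x y (y + 1))) :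
    ∀ᵐ ω ∂μ, (X (x, y) ω).i₂ = (X (x, y + 1) ω).i₁ := by
  have hsub : {ω | ¬ (X (x, y) ω).i₂ = (X (x, y + 1) ω).i₁} ⊆
      ⋃ c : {c : ArrowConfig × ArrowConfig // c.1.i₂ ≠ c.2.i₁},
        {ω | ∀ v ∈ rect x x y (y + 1), X v ω = if v.2 = y then c.1.1 else c.1.2} := by
    intro ω hω
    refine Set.mem_iUnion.2 ⟨⟨(X (x, y) ω, X (x, y + 1) ω), hω⟩, fun v hv => ?_⟩
    rw [mem_rect] at hv
    split_ifs with hvx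
    · congr 1; ext <;> simp only <;> omega
    · congr 1; ext <;> simp only <;> omega
  refine measure_mono_null hsub (measure_iUnion_null fun c => ?_)
  rw [h, boxWeight, Finset.prod_eq_zero (i := (x, y + 1)), ENNReal.ofReal_zero]
  · simp only [mem_rect]; omega
  · simp [vFactor, mem_rect, c.2]

/-- Extend the ensembles by `default` beyond their quadrants and take a limit in the compact space
of probability measures along a nonprincipal ultrafilter. The limit is only a field of
configurations, with no consistency built in. -/
theorem exists_field_hasBoxLaw (P : Params) (hq : P.q = phi P.B₁ P.B₂ P.p) :
    ∃ m : Measure (ℤ × ℤ → ArrowConfig), IsProbabilityMeasure m ∧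
      ∀ a b c d, HasBoxLaw P m (fun v f => f v) (rect a b c d) := by
  have hmeas : ∀ N : ℕ, Measurable fun (E : Ensemble (quadrant N)) v => config v E := fun N =>
    measurable_pi_lambda _ measurable_config
  let m : ℕ → ProbabilityMeasure (ℤ × ℤ → ArrowConfig) := fun N =>
    ⟨(muN P.B₁ P.B₂ P.p N).map fun E v => config v E,
      Measure.isProbabilityMeasure_map (hmeas N).aemeasurable⟩
  obtain ⟨μ, -, hμ⟩ := isCompact_univ.ultrafilter_le_nhds ((hyperfilter ℕ).map m) (by simp)
  have htend : Tendsto m (hyperfilter ℕ) (𝓝 μ) := hμ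
  refine ⟨μ, inferInstance, fun a b c d F => ?_⟩
  -- Clopen sets have empty frontier, so their probabilities pass to the weak limit.
  have hclopen : IsClopen {f : ℤ × ℤ → ArrowConfig | ∀ v ∈ rect a b c d, f v = F v} := by
    have : {f : ℤ × ℤ → ArrowConfig | ∀ v ∈ rect a b c d, f v = F v} =
        ⋂ v ∈ rect a b c d, (fun f => f v) ⁻¹' {F v} := by ext; simp
    rw [this]
    exact isClopen_biInter_finset fun v _ => (isClopen_discrete _).preimage (continuous_apply v)
  have hlim := ProbabilityMeasure.tendsto_measure_of_null_frontier_of_tendsto' htend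
    (E := {f | ∀ v ∈ rect a b c d, f v = F v}) (by rw [hclopen.frontier_eq, measure_empty])
  refine tendsto_nhds_unique hlim (tendsto_const_nhds.congr' ?_)
  have hev : ∀ᶠ N : ℕ in atTop, -(N : ℤ) < a ∧ -(N : ℤ) < c := by
    filter_upwards [eventually_ge_atTop (max (-a) (-c) + 1).toNat] with N hN
    omega
  filter_upwards [Nat.hyperfilter_le_atTop hev] with N hN
  change _ = (muN P.B₁ P.B₂ P.p N).map _ _
  rw [Measure.map_apply (hmeas N) (measurableSet_agree measurable_pi_apply _ _)]
  exact (hasBoxLaw_muN P hq N a b c d hN.1 hN.2 F).symm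

/-- Consistency amounts to countably many almost sure conditions, so the field lives on the
measurable set `A` of consistent fields and can be transported to ensembles. -/
theorem exists_measure_hasBoxLaw (P : Params) (hq : P.q = phi P.B₁ P.B₂ P.p) :
    ∃ μ : Measure (Ensemble Set.univ), IsProbabilityMeasure μ ∧
      ∀ a b c d, HasBoxLaw P μ config (rect a b c d) := by
  obtain ⟨m, hm, hlaw⟩ := exists_field_hasBoxLaw P hq
  set A : Set (ℤ × ℤ → ArrowConfig) := {f | (∀ x y, (f (x, y)).j₂ = (f (x + 1, y)).j₁) ∧
    ∀ x y, (f (x, y)).i₂ = (f (x, y + 1)).i₁} with hA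
  have hAe : ∀ᵐ f ∂m, f ∈ A := by
    refine Filter.Eventually.and ?_ ?_
    · exact ae_all_iff.2 fun x => ae_all_iff.2 fun y => (hlaw _ _ _ _).ae_horizontal x y
    · exact ae_all_iff.2 fun x => ae_all_iff.2 fun y => (hlaw _ _ _ _).ae_vertical x y
  have hAm : MeasurableSet A := by
    have e : ∀ (f : ArrowConfig → Fin 2) v, Measurable fun g : ℤ × ℤ → ArrowConfig => f (g v) :=
      fun f v => (Measurable.of_discrete (f := f)).comp (measurable_pi_apply v)
    rw [hA, Set.ofPred_and]
    simp only [Set.ofPred_forall]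
    refine MeasurableSet.inter ?_ ?_
    · exact MeasurableSet.iInter fun x => MeasurableSet.iInter fun y =>
        measurableSet_eq_fun (e _ _) (e _ _)
    · exact MeasurableSet.iInter fun x => MeasurableSet.iInter fun y =>
        measurableSet_eq_fun (e _ _) (e _ _)
  let r : A → Ensemble Set.univ := fun f =>
    ⟨fun v => f.1 v.1, fun x y _ _ => f.2.1 x y, fun x y _ _ => f.2.2 x y⟩
  have hr : Measurable r := measurable_comap_iff.2 (measurable_pi_lambda _ fun v =>
    (measurable_pi_apply v.1).comp measurable_subtype_coe)
  have key : ∀ s : Set (ℤ × ℤ → ArrowConfig), m.comap (Subtype.val : A → _) (Subtype.val ⁻¹' s) =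
      m s := by
    intro s
    rw [(MeasurableEmbedding.subtype_coe hAm).comap_preimage, Subtype.range_coe]
    rw [Set.inter_comm]
    exact Measure.measure_inter_eq_of_ae hAe
  refine ⟨(m.comap (Subtype.val : A → _)).map r, ⟨?_⟩, fun a b c d F => ?_⟩
  · rw [Measure.map_apply hr MeasurableSet.univ]
    exact (key Set.univ).trans measure_univ
  · rw [Measure.map_apply hr (measurableSet_agree measurable_config _ _), ← hlaw, ← key]
    congr 1
    ext f
    refine forall₂_congr fun v _ => ?_
    rw [config_of_mem (Set.mem_univ v)]

/-! ### Translation invariance, ergodicity, slope -/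

theorem exists_subset_square (I : Finset (ℤ × ℤ)) : ∃ n : ℕ, I ⊆ rect (-n) n (-n) n := by
  induction I using Finset.induction_on with
  | empty => exact ⟨0, Finset.empty_subset _⟩
  | insert v I _ ih =>
    obtain ⟨n, hn⟩ := ih
    refine ⟨max n (max v.1.natAbs v.2.natAbs), Finset.insert_subset ?_ fun u hu => ?_⟩
    · simp only [mem_rect]; omega
    · have := hn hu
      simp only [mem_rect] at this ⊢; omega

section Plane

variable {P : Params} {μ : Measure (Ensemble Set.univ)}

theorem measurable_translatePlane (u : ℤ × ℤ) : Measurable (translatePlane u) :=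
  measurable_translate _ _

theorem config_translatePlane (u v : ℤ × ℤ) (E : Ensemble Set.univ) :
    config v (translatePlane u E) = config (v + u) E :=
  config_translate u _ (Set.mem_univ v) E

theorem preimage_translatePlane_agree (s t a b c d : ℤ) (F : ℤ × ℤ → ArrowConfig) :
    translatePlane (s, t) ⁻¹' {E | ∀ v ∈ rect a b c d, config v E = F v} =
      {E | ∀ v ∈ rect (a + s) (b + s) (c + t) (d + t), config v E = F (v - (s, t))} := by
  ext E
  simp only [Set.mem_preimage, Set.mem_ofPred_eq, config_translatePlane]
  constructor
  · intro h v hv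
    have := h (v - (s, t)) (by
      simp only [mem_rect, Prod.fst_sub, Prod.snd_sub] at hv ⊢; omega)
    rwa [sub_add_cancel] at this
  · intro h v hv
    have := h (v + (s, t)) (by
      simp only [mem_rect, Prod.fst_add, Prod.snd_add] at hv ⊢; omega)
    rwa [add_sub_cancel_right] at this

theorem isTranslationInvariant_of_hasBoxLaw [IsFiniteMeasure μ]
    (h : ∀ a b c d, HasBoxLaw P μ config (rect a b c d)) : IsTranslationInvariant μ := by
  rintro ⟨s, t⟩
  refine ext_of_agree fun I _ => ?_
  obtain ⟨n, hn⟩ := exists_subset_square I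
  refine ⟨_, hn, Set.subset_univ _, fun F => ?_⟩
  rw [Measure.map_apply (measurable_translatePlane _) (measurableSet_agree measurable_config _ _),
    preimage_translatePlane_agree, h, h, boxWeight_translate]
  simp

/-- The configuration on the square `[-n, n]²`. -/
noncomputable def squareConfig (n : ℕ) (E : Ensemble Set.univ) :
    rect (-n) n (-n) n → ArrowConfig := fun v => config v.1 E

theorem measurable_squareConfig (n : ℕ) : Measurable (squareConfig n) :=
  measurable_pi_lambda _ fun v => measurable_config v.1

/-- The shift moves the square diagonally to the lower right, just past its corner, where
`HasBoxLaw.antidiagonal` applies. -/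
theorem indepFun_squareConfig [IsProbabilityMeasure μ]
    (h : ∀ a b c d, HasBoxLaw P μ config (rect a b c d)) (n : ℕ) :
    IndepFun (squareConfig n)
      (squareConfig n ∘ translatePlane (2 * (n : ℤ) + 1, -(2 * (n : ℤ) + 1))) μ := by
  have hX := measurable_squareConfig n
  have hY := hX.comp (measurable_translatePlane (2 * (n : ℤ) + 1, -(2 * (n : ℤ) + 1)))
  rw [indepFun_iff_map_prod_eq_prod_map_map hX.aemeasurable hY.aemeasurable]
  refine Measure.ext_of_singleton fun ⟨f, g⟩ => ?_
  rw [← Set.singleton_prod_singleton, Measure.prod_prod,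
    Measure.map_apply (hX.prodMk hY) ((measurableSet_singleton _).prod (measurableSet_singleton _)),
    Measure.map_apply hX (measurableSet_singleton _),
    Measure.map_apply hY (measurableSet_singleton _)]
  set R' := rect ((n : ℤ) + 1) (3 * n + 1) (-3 * n - 1) (-n - 1) with hR'
  let F₁ : ℤ × ℤ → ArrowConfig := fun v => if hv : v ∈ rect (-n) n (-n) n then f ⟨v, hv⟩ else default
  let F₂ : ℤ × ℤ → ArrowConfig := fun v => if hv : v ∈ rect (-n) n (-n) n then g ⟨v, hv⟩ else default
  let F : ℤ × ℤ → ArrowConfig := fun v =>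
    if v ∈ rect (-n) n (-n) n then F₁ v else F₂ (v - (2 * (n : ℤ) + 1, -(2 * (n : ℤ) + 1)))
  have e₁ : squareConfig n ⁻¹' {f} = {E | ∀ v ∈ rect (-n) n (-n) n, config v E = F v} := by
    ext E
    simp only [Set.mem_preimage, Set.mem_singleton_iff, funext_iff, Subtype.forall,
      Set.mem_ofPred_eq]
    refine forall₂_congr fun v hv => ?_
    simp [F, F₁, hv, squareConfig]
  have e₀ : squareConfig n ⁻¹' {g} = {E | ∀ v ∈ rect (-n) n (-n) n, config v E = F₂ v} := by
    ext E
    simp only [Set.mem_preimage, Set.mem_singleton_iff, funext_iff, Subtype.forall,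
      Set.mem_ofPred_eq]
    refine forall₂_congr fun v hv => ?_
    simp [F₂, hv, squareConfig]
  have e₂ : (squareConfig n ∘ translatePlane (2 * (n : ℤ) + 1, -(2 * (n : ℤ) + 1))) ⁻¹' {g} =
      {E | ∀ v ∈ R', config v E = F v} := by
    rw [Set.preimage_comp, e₀, preimage_translatePlane_agree]
    have hRR : rect (-(n : ℤ) + (2 * n + 1)) (n + (2 * n + 1)) (-n + -(2 * n + 1))
        (n + -(2 * n + 1)) = R' := by rw [hR']; congr 1 <;> ring
    rw [hRR]
    ext E
    refine forall₂_congr fun v hv => ?_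
    have : v ∉ rect (-n) n (-n) n := by simp only [hR', mem_rect] at hv ⊢; omega
    simp [F, this]
  have e₃ : (fun E => (squareConfig n E,
      (squareConfig n ∘ translatePlane (2 * (n : ℤ) + 1, -(2 * (n : ℤ) + 1))) E)) ⁻¹' {f} ×ˢ {g} =
      {E | ∀ v ∈ rect (-n) n (-n) n ∪ R', config v E = F v} := by
    have : {E : Ensemble Set.univ | ∀ v ∈ rect (-n) n (-n) n ∪ R', config v E = F v} =
        {E | ∀ v ∈ rect (-n) n (-n) n, config v E = F v} ∩ {E | ∀ v ∈ R', config v E = F v} := by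
      ext E; simp only [Set.mem_ofPred_eq, Set.mem_inter_iff, Finset.mem_union, or_imp, forall_and]
    rw [this, ← e₁, ← e₂]; rfl
  rw [e₁, e₂, e₃, (h _ _ _ _).antidiagonal measurable_config, h, h]

/-- Cylinders form an algebra generating the σ-algebra, hence are dense in measure, and the base of
a cylinder fits into a square. -/
theorem exists_squareConfig_approx (μ : Measure (Ensemble Set.univ)) [IsFiniteMeasure μ]
    {A : Set (Ensemble Set.univ)}
    (hA : MeasurableSet A) {ε : ℝ} (hε : 0 < ε) :
    ∃ (n : ℕ) (B : Set (rect (-n) n (-n) n → ArrowConfig)),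
      μ.real (symmDiff A (squareConfig n ⁻¹' B)) < ε := by
  obtain ⟨A', hA', rfl⟩ := hA
  have hdense : (μ.map Subtype.val).MeasureDense
      (measurableCylinders fun _ : (Set.univ : Set (ℤ × ℤ)) => ArrowConfig) :=
    Measure.MeasureDense.of_generateFrom_isSetAlgebra_finite _ isSetAlgebra_measurableCylinders
      generateFrom_measurableCylinders.symm
  obtain ⟨t, ht, hlt⟩ := hdense.approx A' hA' (measure_ne_top _ _) ε hε
  have htm := hdense.measurable t ht
  obtain ⟨S, B, -, rfl⟩ := (mem_measurableCylinders _).1 ht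
  obtain ⟨n, hn⟩ := exists_subset_square (S.image Subtype.val)
  refine ⟨n, {g | (fun w : S => g ⟨w.1.1, hn (Finset.mem_image_of_mem _ w.2)⟩) ∈ B}, ?_⟩
  have hset : symmDiff (Subtype.val ⁻¹' A') (squareConfig n ⁻¹'
      {g | (fun w : S => g ⟨w.1.1, hn (Finset.mem_image_of_mem _ w.2)⟩) ∈ B}) =
      (Subtype.val ⁻¹' (symmDiff A' (cylinder S B)) : Set (Ensemble Set.univ)) := by
    rw [Set.preimage_symmDiff]
    congr 1
    ext E
    have : (fun w : S => squareConfig n E ⟨w.1.1, hn (Finset.mem_image_of_mem _ w.2)⟩) =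
        S.restrict E.1 := by
      ext1 w
      exact config_of_mem w.1.2 E
    simp only [Set.mem_preimage, Set.mem_ofPred_eq, this, mem_cylinder]
  rw [hset, ← map_measureReal_apply measurable_subtype_coe (hA'.symmDiff htm)]
  exact (ENNReal.toReal_lt_of_lt_ofReal hlt)

/-- For a square event `C` close to `A`, `C` and its shift are independent, whereas `A` equals its
own shift; so `μ(A)` is close to `μ(A)²`. -/
theorem isErgodic_of_hasBoxLaw [IsProbabilityMeasure μ]
    (h : ∀ a b c d, HasBoxLaw P μ config (rect a b c d)) : IsErgodic μ := by
  intro A hA hinv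
  -- `2ε` for replacing `A ∩ T⁻¹A` by `C ∩ T⁻¹C`, and `2ε` for replacing `μ(C)²` by `μ(A)²`.
  have key : ∀ ε > 0, |μ.real A - μ.real A * μ.real A| ≤ 4 * ε := by
    intro ε hε
    obtain ⟨n, B, hB⟩ := exists_squareConfig_approx μ hA hε
    set C := squareConfig n ⁻¹' B with hC
    set T := translatePlane (2 * (n : ℤ) + 1, -(2 * (n : ℤ) + 1)) with hT
    have hCm : MeasurableSet C := measurable_squareConfig n MeasurableSet.of_discrete
    have hTm : Measurable T := measurable_translatePlane _
    have hpres : ∀ s, MeasurableSet s → μ.real (T ⁻¹' s) = μ.real s := fun s hs => by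
      rw [← map_measureReal_apply hTm hs, isTranslationInvariant_of_hasBoxLaw h]
    have hind : μ.real (C ∩ T ⁻¹' C) = μ.real C * μ.real C := by
      have := (indepFun_squareConfig h n).measure_inter_preimage_eq_mul B B
        MeasurableSet.of_discrete MeasurableSet.of_discrete
      rw [Set.preimage_comp, ← hC, ← hT] at this
      rw [measureReal_def, this, ENNReal.toReal_mul]
      congr 1
      exact hpres C hCm
    have h₁ : |μ.real A - μ.real C| ≤ ε :=
      (abs_measureReal_sub_le_measureReal_symmDiff hA.nullMeasurableSet hCm.nullMeasurableSet).trans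
        hB.le
    have h₂ : |μ.real (A ∩ T ⁻¹' A) - μ.real (C ∩ T ⁻¹' C)| ≤ 2 * ε := by
      refine (abs_measureReal_sub_le_measureReal_symmDiff
        (hA.inter (hTm hA)).nullMeasurableSet (hCm.inter (hTm hCm)).nullMeasurableSet).trans ?_
      have hsub : symmDiff (A ∩ T ⁻¹' A) (C ∩ T ⁻¹' C) ⊆ symmDiff A C ∪ T ⁻¹' symmDiff A C := by
        intro E
        simp only [Set.mem_symmDiff, Set.mem_inter_iff, Set.mem_preimage, Set.mem_union]
        tauto
      calc _ ≤ μ.real (symmDiff A C ∪ T ⁻¹' symmDiff A C) := measureReal_mono hsub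
        _ ≤ μ.real (symmDiff A C) + μ.real (T ⁻¹' symmDiff A C) := measureReal_union_le _ _
        _ ≤ 2 * ε := by rw [hpres _ (hA.symmDiff hCm)]; linarith
    rw [hinv, Set.inter_self, hind] at h₂
    have hA1 : μ.real A ≤ 1 := measureReal_le_one
    have hC1 : μ.real C ≤ 1 := measureReal_le_one
    have hA0 : 0 ≤ μ.real A := measureReal_nonneg
    have hC0 : 0 ≤ μ.real C := measureReal_nonneg
    have h₃ : |μ.real C * μ.real C - μ.real A * μ.real A| ≤ 2 * ε := by
      have : μ.real C * μ.real C - μ.real A * μ.real A =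
          -((μ.real A - μ.real C) * (μ.real C + μ.real A)) := by ring
      rw [this, abs_neg, abs_mul, abs_of_nonneg (add_nonneg hC0 hA0)]
      nlinarith [abs_nonneg (μ.real A - μ.real C)]
    calc _ = |(μ.real A - μ.real C * μ.real C) +
          (μ.real C * μ.real C - μ.real A * μ.real A)| := by congr 1; ring
      _ ≤ _ := (abs_add_le _ _).trans (by linarith)
  have hzero : μ.real A - μ.real A * μ.real A = 0 := by
    refine abs_eq_zero.1 (le_antisymm (le_of_forall_pos_le_add fun δ hδ => ?_) (abs_nonneg _))
    have := key (δ / 4) (by positivity)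
    linarith
  have hprod : μ.real A * (1 - μ.real A) = 0 := by linarith
  rcases mul_eq_zero.1 hprod with h0 | h1
  · exact Or.inl ((measureReal_eq_zero_iff).1 h0)
  · refine Or.inr ?_
    rw [← ENNReal.toReal_eq_one_iff, ← measureReal_def]; linarith

theorem integral_config [IsProbabilityMeasure μ]
    (h : ∀ a b c d, HasBoxLaw P μ config (rect a b c d)) (g : ArrowConfig → ℝ) :
    ∫ E, g (config (0, 0) E) ∂μ =
      ∑ c, stochasticWeight P.B₁ P.B₂ c * bernWeight P.q c.j₁ * bernWeight P.p c.i₁ * g c := by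
  rw [← integral_map (φ := config (0, 0)) (f := g) (measurable_config _).aemeasurable
    Measurable.of_discrete.aestronglyMeasurable]
  have : IsProbabilityMeasure (μ.map (config (0, 0))) :=
    Measure.isProbabilityMeasure_map (measurable_config _).aemeasurable
  rw [integral_fintype Integrable.of_finite]
  refine Finset.sum_congr rfl fun c _ => ?_
  rw [map_measureReal_apply (measurable_config _) (measurableSet_singleton c), smul_eq_mul]
  congr 1
  have hset : config (0, 0) ⁻¹' {c} = {E : Ensemble Set.univ | ∀ v ∈ rect 0 0 0 0,
      config v E = (fun _ => c) v} := by
    have hv : ∀ v : ℤ × ℤ, v ∈ rect 0 0 0 0 ↔ v = (0, 0) := fun v => by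
      rw [mem_rect, Prod.ext_iff]; simp only; omega
    ext E; simp [hv]
  rw [hset, measureReal_def, h, ENNReal.toReal_ofReal (boxWeight_nonneg _ _ _)]
  simp [boxWeight, rect, hFactor, vFactor]

theorem slope_of_hasBoxLaw [IsProbabilityMeasure μ]
    (h : ∀ a b c d, HasBoxLaw P μ config (rect a b c d)) : slope μ = (P.p, P.q) := by
  have e : ∀ E : Ensemble Set.univ, E.1 ⟨(0, 0), Set.mem_univ _⟩ = config (0, 0) E := fun E =>
    (config_of_mem (Set.mem_univ _) E).symm
  simp only [slope, chiV, chiH, e]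
  rw [integral_config h fun c => ((c.i₂ : ℕ) : ℝ), integral_config h fun c => ((c.j₂ : ℕ) : ℝ)]
  -- With one test function constant, the exit identity gives the mean of a single exiting arrow.
  have h₁ := sum_stochasticWeight_mul_exiting P.balance (fun _ => 1) (fun i => ((i : ℕ) : ℝ))
  have h₂ := sum_stochasticWeight_mul_exiting P.balance (fun j => ((j : ℕ) : ℝ)) (fun _ => 1)
  simp only [one_mul, mul_one, sum_bernWeight] at h₁ h₂
  rw [h₁, h₂]
  simp [bernWeight]

/-! ### Restriction to quadrants and the infinite-volume limit -/

theorem map_restrict_quadrant (hq : P.q = phi P.B₁ P.B₂ P.p) [IsProbabilityMeasure μ]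
    (h : ∀ a b c d, HasBoxLaw P μ config (rect a b c d)) (N : ℕ) :
    μ.map (restrict (Set.subset_univ (quadrant N))) = muN P.B₁ P.B₂ P.p N := by
  have hm := measurable_restrict (Set.subset_univ (quadrant N))
  have : IsProbabilityMeasure (μ.map (restrict (Set.subset_univ (quadrant N)))) :=
    Measure.isProbabilityMeasure_map hm.aemeasurable
  refine ext_of_agree fun I hI => ?_
  obtain ⟨n, hn⟩ := exists_subset_square I
  have hsub : ∀ v ∈ rect (-N + 1) n (-N + 1) n, v ∈ quadrant N := fun v hv => by
    simp only [mem_rect, quadrant, Set.mem_ofPred_eq] at hv ⊢; omega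
  -- The rectangle starts at the corner vertex `(1 - N, 1 - N)` of the quadrant, so it covers every
  -- part of `I` while staying inside.
  refine ⟨rect (-N + 1) n (-N + 1) n, fun v hv => ?_, hsub, fun F => ?_⟩
  · have h₁ := hn hv
    have h₂ : v ∈ quadrant N := hI hv
    simp only [mem_rect, quadrant, Set.mem_ofPred_eq] at h₁ h₂ ⊢; omega
  · rw [Measure.map_apply hm (measurableSet_agree measurable_config _ _),
      hasBoxLaw_muN P hq N _ _ _ _ (by omega) (by omega), ← h]
    congr 1
    ext E
    exact forall₂_congr fun v hv => by rw [config_restrict _ (hsub v hv)]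

theorem restrict_eq_iff {Λ : Set (ℤ × ℤ)} {Λ' : Set (ℤ × ℤ)} (hΛ : Λ' ⊆ Λ) (E : Ensemble Λ)
    (F : Ensemble Λ') : restrict hΛ E = F ↔ ∀ v ∈ Λ', config v E = config v F := by
  rw [Subtype.ext_iff, funext_iff, Subtype.forall]
  refine forall₂_congr fun v hv => ?_
  rw [config_of_mem hv, config_of_mem (hΛ hv)]; rfl

/-- Once the quadrant contains `Λ`, the probability already equals its limit, because `μ` restricts
to `μ_N`. -/
theorem isInfiniteVolumeLimit_of_hasBoxLaw (hq : P.q = phi P.B₁ P.B₂ P.p) [IsProbabilityMeasure μ]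
    (h : ∀ a b c d, HasBoxLaw P μ config (rect a b c d)) :
    IsInfiniteVolumeLimit (muN P.B₁ P.B₂ P.p) μ := by
  intro Λ F
  obtain ⟨n, hn⟩ := exists_subset_square Λ
  refine tendsto_const_nhds.congr' ?_
  filter_upwards [eventually_gt_atTop n] with N hN
  have hΛN : ∀ v ∈ Λ, v ∈ quadrant N := fun v hv => by
    have := hn hv
    simp only [mem_rect, quadrant, Set.mem_ofPred_eq] at this ⊢; omega
  have hset : {E : Ensemble (quadrant N) | ∀ (v : ℤ × ℤ) (hN : v ∈ quadrant N)
      (hΛ : v ∈ (Λ : Set (ℤ × ℤ))), E.1 ⟨v, hN⟩ = F.1 ⟨v, hΛ⟩} =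
      {E | ∀ v ∈ Λ, config v E = config v F} := by
    ext E
    refine forall_congr' fun v => ⟨fun h' hv => ?_, fun h' hN hΛ => ?_⟩
    · rw [config_of_mem (hΛN v hv), config_of_mem (Finset.mem_coe.2 hv), h' (hΛN v hv) hv]
    · rw [← config_of_mem, ← config_of_mem, h' hΛ]
  rw [hset, ← map_restrict_quadrant hq h N, Measure.map_apply (measurable_restrict _)
    (measurableSet_agree measurable_config Λ fun v => config v F)]
  congr 1
  ext E
  rw [Set.mem_ofPred_eq, restrict_eq_iff]
  exact forall₂_congr fun v hv => by rw [config_restrict _ (hΛN v hv)]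

theorem IsInfiniteVolumeLimit.unique {m : ∀ N : ℕ, Measure (Ensemble (quadrant N))}
    {ν : Measure (Ensemble Set.univ)} [IsFiniteMeasure ν] (hν : IsInfiniteVolumeLimit m ν)
    (hμ : IsInfiniteVolumeLimit m μ) : ν = μ := by
  refine ext_of_agree fun I _ => ⟨I, le_rfl, Set.subset_univ _, fun F => ?_⟩
  -- The limit speaks only of ensembles on `I`; a pattern with no extension to the plane defines an
  -- empty event.
  by_cases hE : ∃ E₀ : Ensemble Set.univ, ∀ v ∈ I, config v E₀ = F v
  · obtain ⟨E₀, hE₀⟩ := hE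
    have hset : {E : Ensemble Set.univ | ∀ v ∈ I, config v E = F v} =
        {E | restrict (Set.subset_univ _) E = restrict (Set.subset_univ (I : Set (ℤ × ℤ))) E₀} := by
      ext E
      rw [Set.mem_ofPred_eq, Set.mem_ofPred_eq, restrict_eq_iff]
      exact forall₂_congr fun v hv => by rw [config_restrict _ hv, hE₀ v hv]
    rw [hset]
    exact tendsto_nhds_unique (hν I _) (hμ I _)
  · have hset : {E : Ensemble Set.univ | ∀ v ∈ I, config v E = F v} = ∅ :=
      Set.eq_empty_of_forall_notMem fun E h => hE ⟨E, h⟩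
    rw [hset, measure_empty, measure_empty]

end Plane

/-! ### The Gibbs property -/

section Gibbs

variable {D R : Finset (ℤ × ℤ)}

/-- The outside of a finite set. -/
abbrev outside (D : Finset (ℤ × ℤ)) : Set (ℤ × ℤ) := Set.univ \ (D : Set (ℤ × ℤ))

theorem mem_outside {v : ℤ × ℤ} : v ∈ outside D ↔ v ∉ D := by simp [outside]

theorem consistent_iff {Λ₁ Λ₂ : Set (ℤ × ℤ)} (E : Ensemble Λ₁) (H : Ensemble Λ₂) :
    Consistent E H ↔
      (∀ x y, (x, y) ∈ Λ₁ → (x + 1, y) ∈ Λ₂ → (config (x, y) E).j₂ = (config (x + 1, y) H).j₁) ∧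
      (∀ x y, (x, y) ∈ Λ₁ → (x, y + 1) ∈ Λ₂ → (config (x, y) E).i₂ = (config (x, y + 1) H).i₁) ∧
      (∀ x y, (x, y) ∈ Λ₂ → (x + 1, y) ∈ Λ₁ → (config (x, y) H).j₂ = (config (x + 1, y) E).j₁) ∧
      (∀ x y, (x, y) ∈ Λ₂ → (x, y + 1) ∈ Λ₁ → (config (x, y) H).i₂ = (config (x, y + 1) E).i₁) := by
  unfold Consistent
  refine and_congr ?_ (and_congr ?_ (and_congr ?_ ?_))
  all_goals
    refine forall₄_congr fun x y h h' => ?_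
    rw [config_of_mem h, config_of_mem h']

theorem measurableSet_consistent {Λ₁ Λ₂ : Set (ℤ × ℤ)} (E : Ensemble Λ₁) :
    MeasurableSet {H : Ensemble Λ₂ | Consistent E H} := by
  have hm : ∀ (f : ArrowConfig → Fin 2) v, Measurable fun H : Ensemble Λ₂ => f (config v H) :=
    fun f v => (Measurable.of_discrete (f := f)).comp (measurable_config v)
  simp only [consistent_iff, Set.ofPred_and, Set.ofPred_forall]
  refine MeasurableSet.inter ?_ (MeasurableSet.inter ?_ (MeasurableSet.inter ?_ ?_))
  · exact .iInter fun x => .iInter fun y => .iInter fun _ => .iInter fun _ =>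
      measurableSet_eq_fun measurable_const (hm _ _)
  · exact .iInter fun x => .iInter fun y => .iInter fun _ => .iInter fun _ =>
      measurableSet_eq_fun measurable_const (hm _ _)
  · exact .iInter fun x => .iInter fun y => .iInter fun _ => .iInter fun _ =>
      measurableSet_eq_fun (hm _ _) measurable_const
  · exact .iInter fun x => .iInter fun y => .iInter fun _ => .iInter fun _ =>
      measurableSet_eq_fun (hm _ _) measurable_const

theorem measurable_gibbsProb (w : ArrowConfig → ℝ) {Λ₂ : Set (ℤ × ℤ)}
    (F : Ensemble (D : Set (ℤ × ℤ))) : Measurable fun H : Ensemble Λ₂ => gibbsProb w H F := by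
  unfold gibbsProb
  exact Measurable.ite (measurableSet_consistent F) (measurable_const.div
    (Finset.measurable_sum _ fun F' _ => Measurable.ite (measurableSet_consistent F')
      measurable_const measurable_const)) measurable_const

theorem ensembleWeight_eq (w : ArrowConfig → ℝ) (F : Ensemble (D : Set (ℤ × ℤ))) :
    ensembleWeight w F = ∏ v ∈ D, w (config v F) := by
  rw [Finset.prod_subtype D (p := (· ∈ (D : Set (ℤ × ℤ)))) (by simp), ensembleWeight]
  exact Finset.prod_congr rfl fun v _ => by rw [config_of_mem v.2]

theorem ensembleWeight_nonneg {w : ArrowConfig → ℝ} (hw : ∀ c, 0 ≤ w c)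
    (F : Ensemble (D : Set (ℤ × ℤ))) : 0 ≤ ensembleWeight w F :=
  Finset.prod_nonneg fun _ _ => hw _

open Classical in
/-- The weight of `F` if it is consistent with `H`, and `0` otherwise. -/
noncomputable def consistentWeight (w : ArrowConfig → ℝ) {Λ₂ : Set (ℤ × ℤ)} (H : Ensemble Λ₂)
    (F : Ensemble (D : Set (ℤ × ℤ))) : ℝ :=
  if Consistent F H then ensembleWeight w F else 0

theorem consistentWeight_nonneg {w : ArrowConfig → ℝ} (hw : ∀ c, 0 ≤ w c) {Λ₂ : Set (ℤ × ℤ)}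
    (H : Ensemble Λ₂) (F : Ensemble (D : Set (ℤ × ℤ))) : 0 ≤ consistentWeight w H F := by
  unfold consistentWeight; split_ifs
  exacts [ensembleWeight_nonneg hw F, le_rfl]

open Classical in
theorem gibbsProb_eq (w : ArrowConfig → ℝ) {Λ₂ : Set (ℤ × ℤ)} (H : Ensemble Λ₂)
    (F : Ensemble (D : Set (ℤ × ℤ))) :
    gibbsProb w H F = consistentWeight w H F /
      ∑ F' : Ensemble (D : Set (ℤ × ℤ)), consistentWeight w H F' := by
  unfold gibbsProb consistentWeight
  split_ifs
  · rfl
  · rw [zero_div]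

theorem gibbsProb_nonneg {w : ArrowConfig → ℝ} (hw : ∀ c, 0 ≤ w c) {Λ₂ : Set (ℤ × ℤ)}
    (H : Ensemble Λ₂) (F : Ensemble (D : Set (ℤ × ℤ))) : 0 ≤ gibbsProb w H F := by
  rw [gibbsProb_eq]
  exact div_nonneg (consistentWeight_nonneg hw H F)
    (Finset.sum_nonneg fun _ _ => consistentWeight_nonneg hw H _)

open Classical in
theorem gibbsProb_le_one {w : ArrowConfig → ℝ} (hw : ∀ c, 0 ≤ w c) {Λ₂ : Set (ℤ × ℤ)}
    (H : Ensemble Λ₂) (F : Ensemble (D : Set (ℤ × ℤ))) : gibbsProb w H F ≤ 1 := by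
  rw [gibbsProb_eq]
  exact div_le_one_of_le₀ (Finset.single_le_sum
    (f := fun F' : Ensemble (D : Set (ℤ × ℤ)) => consistentWeight w H F')
    (fun _ _ => consistentWeight_nonneg hw H _) (Finset.mem_univ F))
    (Finset.sum_nonneg fun _ _ => consistentWeight_nonneg hw H _)

-- Holds also when the partition function vanishes: all its terms are nonnegative, hence `0`.
open Classical in
theorem gibbsProb_mul_sum {w : ArrowConfig → ℝ} (hw : ∀ c, 0 ≤ w c) {Λ₂ : Set (ℤ × ℤ)}
    (H : Ensemble Λ₂) (F : Ensemble (D : Set (ℤ × ℤ))) :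
    gibbsProb w H F * ∑ F' : Ensemble (D : Set (ℤ × ℤ)), consistentWeight w H F' =
      consistentWeight w H F := by
  rw [gibbsProb_eq]
  by_cases hZ : ∑ F' : Ensemble (D : Set (ℤ × ℤ)), consistentWeight w H F' = 0
  · rw [hZ, mul_zero]
    exact ((Finset.sum_eq_zero_iff_of_nonneg fun _ _ => consistentWeight_nonneg hw H _).1 hZ F
      (Finset.mem_univ F)).symm
  · rw [div_mul_cancel₀ _ hZ]

/-- `R` contains `D` together with all neighbours of `D`. -/
def ContainsNeighbours (D R : Finset (ℤ × ℤ)) : Prop :=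
  ∀ x y, (x, y) ∈ D → (x, y) ∈ R ∧ (x + 1, y) ∈ R ∧ (x - 1, y) ∈ R ∧ (x, y + 1) ∈ R ∧
    (x, y - 1) ∈ R

theorem consistent_of_agree (hDR : ContainsNeighbours D R) {F : Ensemble (D : Set (ℤ × ℤ))}
    {H H' : Ensemble (outside D)} (hH : ∀ v ∈ R \ D, config v H = config v H')
    (h : Consistent F H) : Consistent F H' := by
  rw [consistent_iff] at h ⊢
  simp only [mem_outside, Finset.mem_coe, Finset.mem_sdiff] at h hH ⊢
  refine ⟨fun x y hx hx' => ?_, fun x y hx hx' => ?_, fun x y hx hx' => ?_, fun x y hx hx' => ?_⟩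
  · rw [← hH _ ⟨(hDR x y hx).2.1, hx'⟩, h.1 x y hx hx']
  · rw [← hH _ ⟨(hDR x y hx).2.2.2.1, hx'⟩, h.2.1 x y hx hx']
  · have := (hDR _ _ hx').2.2.1
    rw [add_sub_cancel_right] at this
    rw [← hH _ ⟨this, hx⟩, h.2.2.1 x y hx hx']
  · have := (hDR _ _ hx').2.2.2.2
    rw [add_sub_cancel_right] at this
    rw [← hH _ ⟨this, hx⟩, h.2.2.2 x y hx hx']

/-- The interaction has range one, so the conditional probability is constant on each cylinder over
`R \ D`. -/
theorem gibbsProb_congr (hDR : ContainsNeighbours D R) (w : ArrowConfig → ℝ)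
    {H H' : Ensemble (outside D)} (hH : ∀ v ∈ R \ D, config v H = config v H')
    (F : Ensemble (D : Set (ℤ × ℤ))) : gibbsProb w H F = gibbsProb w H' F := by
  have : ∀ F' : Ensemble (D : Set (ℤ × ℤ)), consistentWeight w H F' = consistentWeight w H' F' := by
    intro F'
    classical
    unfold consistentWeight
    exact if_congr ⟨consistent_of_agree hDR hH,
      consistent_of_agree hDR fun v hv => (hH v hv).symm⟩ rfl rfl
  simp only [gibbsProb_eq, this]

/-- The configuration that is `F` on `D` and `H` outside. -/
noncomputable def glue (F : Ensemble (D : Set (ℤ × ℤ))) (H : Ensemble (outside D)) (v : ℤ × ℤ) :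
    ArrowConfig :=
  if v ∈ D then config v F else config v H

theorem hFactor_glue_ne_zero {q : ℝ} {F : Ensemble (D : Set (ℤ × ℤ))} {H : Ensemble (outside D)}
    {x y : ℤ} (h : hFactor q R (glue F H) (x + 1, y) ≠ 0) (hx : (x, y) ∈ R) :
    (glue F H (x, y)).j₂ = (glue F H (x + 1, y)).j₁ := by
  by_contra hne
  exact h (by simp [hFactor, hx, hne])

theorem vFactor_glue_ne_zero {p : ℝ} {F : Ensemble (D : Set (ℤ × ℤ))} {H : Ensemble (outside D)}
    {x y : ℤ} (h : vFactor p R (glue F H) (x, y + 1) ≠ 0) (hx : (x, y) ∈ R) :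
    (glue F H (x, y)).i₂ = (glue F H (x, y + 1)).i₁ := by
  by_contra hne
  exact h (by simp [vFactor, hx, hne])

/-- Every edge between `D` and its outside has both ends in `R`, so its consistency indicator is a
factor of the weight. -/
theorem consistent_of_boxWeight_ne_zero (hDR : ContainsNeighbours D R) {P : Params}
    {F : Ensemble (D : Set (ℤ × ℤ))} {H : Ensemble (outside D)}
    (h : boxWeight P R (glue F H) ≠ 0) : Consistent F H := by
  have hne := Finset.prod_ne_zero_iff.1 h
  have hh : ∀ x y, (x, y) ∈ R → (x + 1, y) ∈ R →
      (glue F H (x, y)).j₂ = (glue F H (x + 1, y)).j₁ := fun x y hx hx' =>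
    hFactor_glue_ne_zero (right_ne_zero_of_mul (left_ne_zero_of_mul (hne _ hx'))) hx
  have hv : ∀ x y, (x, y) ∈ R → (x, y + 1) ∈ R →
      (glue F H (x, y)).i₂ = (glue F H (x, y + 1)).i₁ := fun x y hx hx' =>
    vFactor_glue_ne_zero (right_ne_zero_of_mul (hne _ hx')) hx
  rw [consistent_iff]
  simp only [mem_outside, Finset.mem_coe]
  refine ⟨fun x y hx hx' => ?_, fun x y hx hx' => ?_, fun x y hx hx' => ?_, fun x y hx hx' => ?_⟩
  · have := hh x y (hDR x y hx).1 (hDR x y hx).2.1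
    rwa [glue, glue, if_pos hx, if_neg hx'] at this
  · have := hv x y (hDR x y hx).1 (hDR x y hx).2.2.2.1
    rwa [glue, glue, if_pos hx, if_neg hx'] at this
  · have := (hDR _ _ hx').2.2.1
    rw [add_sub_cancel_right] at this
    have := hh x y this (hDR _ _ hx').1
    rwa [glue, glue, if_neg hx, if_pos hx'] at this
  · have := (hDR _ _ hx').2.2.2.2
    rw [add_sub_cancel_right] at this
    have := hv x y this (hDR _ _ hx').1
    rwa [glue, glue, if_neg hx, if_pos hx'] at this

theorem config_horizontal {Λ : Set (ℤ × ℤ)} (E : Ensemble Λ) {x y : ℤ} (h : (x, y) ∈ Λ)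
    (h' : (x + 1, y) ∈ Λ) : (config (x, y) E).j₂ = (config (x + 1, y) E).j₁ := by
  rw [config_of_mem h, config_of_mem h']; exact E.2.1 x y h h'

theorem config_vertical {Λ : Set (ℤ × ℤ)} (E : Ensemble Λ) {x y : ℤ} (h : (x, y) ∈ Λ)
    (h' : (x, y + 1) ∈ Λ) : (config (x, y) E).i₂ = (config (x, y + 1) E).i₁ := by
  rw [config_of_mem h, config_of_mem h']; exact E.2.2 x y h h'

theorem Consistent.glue_horizontal {F : Ensemble (D : Set (ℤ × ℤ))} {H : Ensemble (outside D)}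
    (h : Consistent F H) (x y : ℤ) : (glue F H (x, y)).j₂ = (glue F H (x + 1, y)).j₁ := by
  obtain ⟨h₁, -, h₃, -⟩ := (consistent_iff F H).1 h
  unfold glue
  split_ifs with hx hx' hx'
  · exact config_horizontal F hx hx'
  · exact h₁ x y hx (mem_outside.2 hx')
  · exact h₃ x y (mem_outside.2 hx) hx'
  · exact config_horizontal H (mem_outside.2 hx) (mem_outside.2 hx')

theorem Consistent.glue_vertical {F : Ensemble (D : Set (ℤ × ℤ))} {H : Ensemble (outside D)}
    (h : Consistent F H) (x y : ℤ) : (glue F H (x, y)).i₂ = (glue F H (x, y + 1)).i₁ := by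
  obtain ⟨-, h₂, -, h₄⟩ := (consistent_iff F H).1 h
  unfold glue
  split_ifs with hx hx' hx'
  · exact config_vertical F hx hx'
  · exact h₂ x y hx (mem_outside.2 hx')
  · exact h₄ x y (mem_outside.2 hx) hx'
  · exact config_vertical H (mem_outside.2 hx) (mem_outside.2 hx')

/-- The weight of a configuration on `R` factors into a function of its part outside `D` and the
weight of its part on `D`. -/
theorem exists_boxWeight_glue_eq (hDR : ContainsNeighbours D R) (P : Params)
    (H : Ensemble (outside D)) :
    ∃ K : ℝ, 0 ≤ K ∧ ∀ F : Ensemble (D : Set (ℤ × ℤ)), boxWeight P R (glue F H) =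
      K * consistentWeight (stochasticWeight P.B₁ P.B₂) H F := by
  -- The factors at `R \ D` with all consistency indicators set to `1`, which is their value when
  -- `F` and `H` fit together.
  refine ⟨∏ v ∈ R \ D, (stochasticWeight P.B₁ P.B₂ (config v H) *
    (if (v.1 - 1, v.2) ∈ R then 1 else bernWeight P.q (config v H).j₁) *
    (if (v.1, v.2 - 1) ∈ R then 1 else bernWeight P.p (config v H).i₁)), ?_, fun F => ?_⟩
  · refine Finset.prod_nonneg fun v _ => mul_nonneg (mul_nonneg
      (stochasticWeight_nonneg P.hB₁ P.hB₂ _) ?_) ?_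
    · split_ifs
      exacts [zero_le_one, bernWeight_nonneg P.hq _]
    · split_ifs
      exacts [zero_le_one, bernWeight_nonneg P.hp _]
  by_cases hc : Consistent F H
  swap
  · rw [consistentWeight, if_neg hc, mul_zero]
    by_contra hne
    exact hc (consistent_of_boxWeight_ne_zero hDR hne)
  have hsub : D ⊆ R := fun v hv => (hDR v.1 v.2 hv).1
  have hhor : ∀ v : ℤ × ℤ, hFactor P.q R (glue F H) v =
      if (v.1 - 1, v.2) ∈ R then 1 else bernWeight P.q (glue F H v).j₁ := by
    intro v
    have := hc.glue_horizontal (v.1 - 1) v.2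
    rw [sub_add_cancel] at this
    rw [hFactor, if_pos this]
  have hver : ∀ v : ℤ × ℤ, vFactor P.p R (glue F H) v =
      if (v.1, v.2 - 1) ∈ R then 1 else bernWeight P.p (glue F H v).i₁ := by
    intro v
    have := hc.glue_vertical v.1 (v.2 - 1)
    rw [sub_add_cancel] at this
    rw [vFactor, if_pos this]
  rw [consistentWeight, if_pos hc, ensembleWeight_eq, boxWeight, ← Finset.prod_sdiff hsub]
  congr 1
  · refine Finset.prod_congr rfl fun v hv => ?_
    rw [hhor, hver, glue, if_neg (Finset.mem_sdiff.1 hv).2]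
  -- Left and lower neighbours of `D` lie in `R`, so no Bernoulli weight occurs on `D`.
  · refine Finset.prod_congr rfl fun v hv => ?_
    have := hDR v.1 v.2 hv
    rw [hhor, hver, if_pos this.2.2.1, if_pos this.2.2.2.2, glue, if_pos hv, mul_one, mul_one]

variable {P : Params} {μ : Measure (Ensemble Set.univ)}

theorem exists_square_containsNeighbours (D I : Finset (ℤ × ℤ)) :
    ∃ n : ℤ, I ⊆ rect (-n) n (-n) n ∧ ContainsNeighbours D (rect (-n) n (-n) n) := by
  obtain ⟨n, hn⟩ := exists_subset_square (D ∪ I)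
  refine ⟨n + 1, fun v hv => ?_, fun x y hxy => ?_⟩
  · have := hn (Finset.mem_union_right _ hv)
    simp only [mem_rect] at this ⊢; omega
  · have := hn (Finset.mem_union_left _ hxy)
    simp only [mem_rect] at this ⊢; omega

theorem measure_outside_inter_inside (hDR : D ⊆ R) (h : HasBoxLaw P μ config R)
    (F : Ensemble (D : Set (ℤ × ℤ))) (H : Ensemble (outside D)) :
    μ (restrict (Set.sdiff_subset : outside D ⊆ _) ⁻¹'
        {H' | ∀ v ∈ R \ D, config v H' = config v H} ∩
      {E | restrict (Set.subset_univ _) E = F}) = ENNReal.ofReal (boxWeight P R (glue F H)) := by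
  rw [← h]
  congr 1
  ext E
  simp only [Set.mem_inter_iff, Set.mem_preimage, Set.mem_ofPred_eq, restrict_eq_iff]
  constructor
  · rintro ⟨h₁, h₂⟩ v hv
    unfold glue
    split_ifs with hvD
    · exact h₂ v hvD
    · rw [← h₁ v (Finset.mem_sdiff.2 ⟨hv, hvD⟩), config_restrict _ (mem_outside.2 hvD)]
  · intro h'
    refine ⟨fun v hv => ?_, fun v hv => ?_⟩
    · obtain ⟨hvR, hvD⟩ := Finset.mem_sdiff.1 hv
      rw [config_restrict _ (mem_outside.2 hvD), h' v hvR, glue, if_neg hvD]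
    · rw [h' v (hDR hv), glue, if_pos (Finset.mem_coe.1 hv)]

-- On a cylinder fixing the outside as `H` on `R \ D`, the inside `F` has mass `K` times its
-- consistent weight. Summing over all insides gives `K` times the partition function, so the
-- density is the Gibbs ratio.
open Classical in
theorem map_restrict_outside_eq_withDensity [IsProbabilityMeasure μ]
    (h : ∀ a b c d, HasBoxLaw P μ config (rect a b c d)) (F : Ensemble (D : Set (ℤ × ℤ))) :
    (μ.restrict {E | restrict (Set.subset_univ _) E = F}).map
        (restrict (Set.sdiff_subset : outside D ⊆ _)) =
      (μ.map (restrict (Set.sdiff_subset : outside D ⊆ _))).withDensity fun H =>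
        ENNReal.ofReal (gibbsProb (stochasticWeight P.B₁ P.B₂) H F) := by
  have hout := measurable_restrict (Set.sdiff_subset : outside D ⊆ _)
  have hw := stochasticWeight_nonneg P.hB₁ P.hB₂
  refine ext_of_agree fun I hI => ?_
  obtain ⟨n, hn, hDR⟩ := exists_square_containsNeighbours D I
  set R := rect (-n) n (-n) n with hR
  have hsub : D ⊆ R := fun v hv => (hDR v.1 v.2 hv).1
  refine ⟨R \ D, fun v hv => Finset.mem_sdiff.2 ⟨hn hv, mem_outside.1 (hI hv)⟩,
    fun v hv => mem_outside.2 (Finset.mem_sdiff.1 hv).2, fun G => ?_⟩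
  by_cases hG : ∃ H : Ensemble (outside D), ∀ v ∈ R \ D, config v H = G v
  swap
  · have hset : {H : Ensemble (outside D) | ∀ v ∈ R \ D, config v H = G v} = ∅ :=
      Set.eq_empty_of_forall_notMem fun H hH => hG ⟨H, hH⟩
    rw [hset, measure_empty, measure_empty]
  obtain ⟨H, hH⟩ := hG
  have hset : {H' : Ensemble (outside D) | ∀ v ∈ R \ D, config v H' = G v} =
      {H' | ∀ v ∈ R \ D, config v H' = config v H} := by
    ext H'
    exact forall₂_congr fun v hv => by rw [hH v hv]
  have hC : MeasurableSet {H' : Ensemble (outside D) | ∀ v ∈ R \ D, config v H' = config v H} :=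
    measurableSet_agree measurable_config _ fun v => config v H
  obtain ⟨K, hK, hKF⟩ := exists_boxWeight_glue_eq hDR P H
  have hsum := sum_measure_preimage_singleton
    (μ := μ.restrict (restrict (Set.sdiff_subset : outside D ⊆ _) ⁻¹'
      {H' | ∀ v ∈ R \ D, config v H' = config v H}))
    (f := restrict (Set.subset_univ (D : Set (ℤ × ℤ)))) Finset.univ
    fun F' _ => measurable_restrict _ (measurableSet_singleton F')
  rw [Finset.coe_univ, Set.preimage_univ, Measure.restrict_apply_univ] at hsum
  have hterm : ∀ F' : Ensemble (D : Set (ℤ × ℤ)),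
      μ.restrict (restrict (Set.sdiff_subset : outside D ⊆ _) ⁻¹'
        {H' | ∀ v ∈ R \ D, config v H' = config v H})
          (restrict (Set.subset_univ (D : Set (ℤ × ℤ))) ⁻¹' {F'}) =
      ENNReal.ofReal (K * consistentWeight (stochasticWeight P.B₁ P.B₂) H F') := by
    intro F'
    rw [Measure.restrict_apply (measurable_restrict _ (measurableSet_singleton F')),
      Set.inter_comm, ← hKF]
    exact measure_outside_inter_inside hsub (h _ _ _ _) F' H
  simp_rw [hterm] at hsum
  rw [← ENNReal.ofReal_sum_of_nonneg fun F' _ => mul_nonneg hK (consistentWeight_nonneg hw H F'),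
    ← Finset.mul_sum] at hsum
  -- The density is constant on the cylinder; its integral is that value times the mass computed in
  -- `hsum`.
  rw [hset, withDensity_apply _ hC, setLIntegral_congr_fun hC
    (g := fun _ => ENNReal.ofReal (gibbsProb (stochasticWeight P.B₁ P.B₂) H F))
    (fun H' hH' => by beta_reduce; rw [gibbsProb_congr hDR _ hH' F]),
    setLIntegral_const, Measure.map_apply hout hC, Measure.map_apply hout hC, ← hsum,
    Measure.restrict_apply (hout hC), measure_outside_inter_inside hsub (h _ _ _ _) F H, hKF,
    ← ENNReal.ofReal_mul (gibbsProb_nonneg hw H F), mul_left_comm, gibbsProb_mul_sum hw]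

/-- Conditional expectation is characterized by integrals over events of the outside, and these are
the density identity evaluated on such events. -/
theorem isGibbs_of_hasBoxLaw [IsProbabilityMeasure μ]
    (h : ∀ a b c d, HasBoxLaw P μ config (rect a b c d)) :
    IsGibbs (stochasticWeight P.B₁ P.B₂) μ := by
  intro D hD _ F
  have hw := stochasticWeight_nonneg P.hB₁ P.hB₂
  have hout := measurable_restrict (Set.sdiff_subset : outside D ⊆ _)
  have hg := measurable_gibbsProb (stochasticWeight P.B₁ P.B₂) (Λ₂ := outside D) F
  have hA : MeasurableSet {E : Ensemble Set.univ | restrict hD E = F} :=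
    measurable_restrict hD (measurableSet_singleton F)
  have hint : Integrable (fun E : Ensemble Set.univ => gibbsProb (stochasticWeight P.B₁ P.B₂)
      (restrict (Set.sdiff_subset : outside D ⊆ _) E) F) μ :=
    Integrable.of_bound (hg.comp hout).aestronglyMeasurable 1 (ae_of_all _ fun E => by
      rw [Real.norm_of_nonneg (gibbsProb_nonneg hw _ F)]; exact gibbsProb_le_one hw _ F)
  refine (ae_eq_condExp_of_forall_setIntegral_eq hout.comap_le
    ((integrable_const (1 : ℝ)).indicator hA) (fun _ _ _ => hint.integrableOn) ?_ ?_).symm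
  · rintro _ ⟨t, ht, rfl⟩ -
    have hkey := congrArg (fun ν => ν t) (map_restrict_outside_eq_withDensity h F)
    simp only [Measure.map_apply hout ht, withDensity_apply _ ht] at hkey
    rw [Measure.restrict_apply (hout ht), setLIntegral_map ht hg.ennreal_ofReal hout] at hkey
    rw [integral_eq_lintegral_of_nonneg_ae (ae_of_all _ fun E => gibbsProb_nonneg hw _ F)
      (hg.comp hout).aestronglyMeasurable.restrict, ← hkey, setIntegral_indicator hA,
      setIntegral_const, smul_eq_mul, mul_one, measureReal_def]
  · exact (hg.comp (comap_measurable _)).aestronglyMeasurable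

end Gibbs

/-! ### Solving the balance equation by `φ`, and conclusion -/

theorem exists_params {B₁ B₂ ρ : ℝ} (hB₁ : 0 < B₁) (hB₁₂ : B₁ < B₂) (hB₂ : B₂ < 1)
    (hρ : ρ ∈ Set.Icc (0 : ℝ) 1) :
    ∃ P : Params, P.B₁ = B₁ ∧ P.B₂ = B₂ ∧ P.p = ρ ∧ P.q = phi B₁ B₂ ρ := by
  -- `B₁ < B₂` gives `κ ≥ 1`, which keeps the denominator of `φ` positive on `[0, 1]`.
  have hκ : 1 ≤ kappa B₁ B₂ := by
    rw [kappa, le_div_iff₀ (by linarith)]; linarith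
  have hden : 0 < (kappa B₁ B₂ - 1) * ρ + 1 := by
    have := mul_nonneg (sub_nonneg.2 hκ) hρ.1
    linarith
  have hk : kappa B₁ B₂ * (1 - B₂) = 1 - B₁ := div_mul_cancel₀ _ (by linarith)
  have hphi : phi B₁ B₂ ρ * ((kappa B₁ B₂ - 1) * ρ + 1) = kappa B₁ B₂ * ρ :=
    div_mul_cancel₀ _ hden.ne'
  refine ⟨⟨B₁, B₂, ρ, phi B₁ B₂ ρ, ⟨by linarith, by linarith⟩, ⟨by linarith, by linarith⟩, hρ,
    ⟨div_nonneg (mul_nonneg (by linarith) hρ.1) hden.le, ?_⟩, ?_⟩, rfl, rfl, rfl, rfl⟩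
  · rw [phi, div_le_one hden]
    linarith [hρ.2]
  -- The definition of `φ` rearranges to `φ(ρ)(1 - ρ) = κρ(1 - φ(ρ))`; multiplying by `1 - B₂` gives
  -- balance.
  · rw [← hk]
    linear_combination -(1 - B₂) * hphi

end SixVertex

theorem mainTheorem4 (B₁ B₂ ρ : ℝ) (hB₁ : 0 < B₁) (hB₁₂ : B₁ < B₂) (hB₂ : B₂ < 1)
    (hρ : ρ ∈ Set.Icc (0 : ℝ) 1) :
    ∃ μ : MeasureTheory.Measure (SixVertex.Ensemble Set.univ),
      SixVertex.IsPureState (SixVertex.stochasticWeight B₁ B₂) μ ∧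
      SixVertex.slope μ = (ρ, SixVertex.phi B₁ B₂ ρ) ∧
      SixVertex.IsInfiniteVolumeLimit (SixVertex.muN B₁ B₂ ρ) μ ∧
      (∀ ν : MeasureTheory.Measure (SixVertex.Ensemble Set.univ),
        MeasureTheory.IsProbabilityMeasure ν →
        SixVertex.IsInfiniteVolumeLimit (SixVertex.muN B₁ B₂ ρ) ν → ν = μ) ∧
      (∀ N : ℕ, μ.map (SixVertex.restrict (Set.subset_univ (SixVertex.quadrant N))) =
        SixVertex.muN B₁ B₂ ρ N) := by
  obtain ⟨P, rfl, rfl, rfl, hq⟩ := SixVertex.exists_params hB₁ hB₁₂ hB₂ hρ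
  obtain ⟨μ, hμ, h⟩ := SixVertex.exists_measure_hasBoxLaw P hq
  have hlim := SixVertex.isInfiniteVolumeLimit_of_hasBoxLaw hq h
  exact ⟨μ, ⟨hμ, SixVertex.isTranslationInvariant_of_hasBoxLaw h,
    SixVertex.isErgodic_of_hasBoxLaw h, SixVertex.isGibbs_of_hasBoxLaw h⟩,
    (SixVertex.slope_of_hasBoxLaw h).trans (by rw [hq]), hlim, fun ν _ hν => hν.unique hlim,
    SixVertex.map_restrict_quadrant hq h⟩
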